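/- Let $n\ge 2$, let $X$ be a compact Hausdorff space and let $\sigma=(\sigma_1,\dots,\sigma_n)$ be continuous maps $X\to X$ such that $X=\bigcup_{i=1}^n\sigma_i(X)$ (a surjective compact multivariable dynamical system). For a word $w=i_1\cdots i_k$ in $\{1,\dots,n\}$ put $|w|=k$ and $\sigma_w=\sigma_{i_1}\circ\cdots\circ\sigma_{i_k}$. The system is \emph{minimal} if for every $x\in X$ the orbit $\{\sigma_w(x): w \text{ a word}\}$ is dense in $X$. Let $\mathcal A_0$ be the algebra of polynomials $\sum_w \mathfrak s_w f_w$ in $\mathfrak s_1,\dots,\mathfrak s_n$ with coefficients $f_w\in C(X)$, multiplied according to $f\mathfrak s_i=\mathfrak s_i(f\circ\sigma_i)$. The tensor algebra $\mathcal A(X,\sigma)$ is the operator algebra obtained by completing $\mathcal A_0$ in the matrix norms given by the supremum over all representations $\rho$ on Hilbert space for which $\rho|_{C(X)}$ is a $*$-homomorphism and $\|[\rho(\mathfrak s_1)\ \cdots\ \rho(\mathfrak s_n)]\|\le 1$. Let $\mathfrak A=\mathrm C^*_{\mathrm e}(\mathcal A(X,\sigma))$ be its C*-envelope: a C*-algebra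 with a completely isometric homomorphism $j:\mathcal A(X,\sigma)\to\mathfrak A$ whose range generates $\mathfrak A$, such that for every completely isometric homomorphism $k$ of $\mathcal A(X,\sigma)$ into a C*-algebra generated by its range there is a surjective $*$-homomorphism $q:\mathrm C^*(k(\mathcal A(X,\sigma)))\to\mathfrak A$ with $qk=j$. Write $\mathfrak t_i=j(\mathfrak s_i)$ and $\mathfrak t_w=\mathfrak t_{i_1}\cdots\mathfrak t_{i_k}$. Let $\tilde X$ be the space of all pairs of sequences $(\mathbf i,\mathbf x)\in\{1,\dots,n\}^{\mathbb N}\times X^{\mathbb N}$ with $\sigma_{i_k}(x_{k+1})=x_k$ for all $k\ge0$, with the product topology; let $p(\mathbf i,\mathbf x)=x_0$ and $\tilde\sigma_i(\mathbf i,\mathbf x)=\big((i,i_0,i_1,\dots),(\sigma_i(x_0),x_0,x_1,\dots)\big)$. Then there is exactly one unital $*$-homomorphism $\pi:C(\tilde X)\to\mathfrak A$ with $\pi(f\circ p)=j(f)$ for $f\in C(X)$ and $\pi(g)\mathfrak t_i=\mathfrak t_i\,\pi(g\circ\tilde\sigma_i)$ for $g\in C(\tilde X)$, $1\le i\le n$;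 write $g$ for $\pi(g)$. Let \[ \mathfrak B=\overline{\operatorname{span}}\{\mathfrak t_u\, g\,\mathfrak t_v^*: |u|=|v|,\ g\in C(\tilde X)\}\subseteq\mathfrak A,\qquad \alpha(b)=VbV^*\ (b\in\mathfrak B),\qquad V=\tfrac1{\sqrt n}\sum_{i=1}^n\mathfrak t_i . \] A closed two-sided ideal $\mathfrak J$ of $\mathfrak B$ is \emph{$\alpha$-invariant} if $\alpha(\mathfrak J)\subseteq\mathfrak J$, and \emph{$\alpha$-bi-invariant} if in addition $b\in\mathfrak J$ whenever $b\in\mathfrak B$ and $\alpha(b)\in\mathfrak J$; it is \emph{proper} if $\mathfrak J\ne\{0\}$ and $\mathfrak J\ne\mathfrak B$. Then the following are equivalent: (1) $(X,\sigma)$ is minimal; (2) $\mathfrak B$ has no proper $\alpha$-invariant ideals; (3) $\mathfrak B$ has no proper $\alpha$-bi-invariant ideals. -/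

import Mathlib

universe u

noncomputable section

namespace MvDyn

/-! ### Multivariable dynamical systems

A compact multivariable dynamical system is a compact Hausdorff space `X` together with
continuous maps `σ 0, …, σ (n-1) : X → X` (properness is automatic on a compact Hausdorff space). -/

section Dynamics

variable {X : Type u} [TopologicalSpace X] {n : ℕ}

/-- `σ_w = σ_{i₁} ∘ ⋯ ∘ σ_{iₖ}` for the word `w = i₁ ⋯ iₖ`; the empty word gives the identity. -/
def wordMap (σ : Fin n → C(X, X)) : List (Fin n) → X → X
  | [], x => x
  | i :: w, x => σ i (wordMap σ w x)

/-- The system is surjective: `X` is the union of the ranges of the maps `σ i`. -/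
def IsSurjective (σ : Fin n → C(X, X)) : Prop :=
  (⋃ i, Set.range (σ i)) = Set.univ

/-- The orbit `{σ_w(x) : w a word}`. -/
def orbit (σ : Fin n → C(X, X)) (x : X) : Set X :=
  Set.range fun w : List (Fin n) => wordMap σ w x

/-- The system is minimal: every orbit is dense. -/
def IsMinimal (σ : Fin n → C(X, X)) : Prop :=
  ∀ x, Dense (orbit σ x)

/-! ### The covering system -/

/-- The covering space: all infinite tails `(i, x)`, that is, sequences `i` of indices and `x` of
points with `σ_{i_k}(x_{k+1}) = x_k` for all `k`, as a subspace of the product space. -/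
def Cover (σ : Fin n → C(X, X)) : Type u :=
  {z : (ℕ → Fin n) × (ℕ → X) // ∀ k, σ (z.1 k) (z.2 (k + 1)) = z.2 k}

instance (σ : Fin n → C(X, X)) : TopologicalSpace (Cover σ) :=
  inferInstanceAs (TopologicalSpace
    {z : (ℕ → Fin n) × (ℕ → X) // ∀ k, σ (z.1 k) (z.2 (k + 1)) = z.2 k})

/-- The projection `p (i, x) = x₀` of the covering space onto `X`. -/
def coverProj (σ : Fin n → C(X, X)) : C(Cover σ, X) where
  toFun z := z.1.2 0
  continuous_toFun :=
    (continuous_apply 0).comp (continuous_snd.comp continuous_subtype_val)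

/-- The sequence `(a, s₀, s₁, …)`. -/
def consSeq {A : Type*} (a : A) (s : ℕ → A) : ℕ → A
  | 0 => a
  | k + 1 => s k

/-- The maps `σ̃ᵢ ((i₀, i₁, …), (x₀, x₁, …)) = ((i, i₀, i₁, …), (σᵢ(x₀), x₀, x₁, …))` of the
covering system. -/
def coverMap (σ : Fin n → C(X, X)) (i : Fin n) : C(Cover σ, Cover σ) where
  toFun z := ⟨(consSeq i z.1.1, consSeq (σ i (z.1.2 0)) z.1.2), fun k => by
    cases k with
    | zero => rfl
    | succ k => exact z.2 k⟩
  continuous_toFun := by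
    have h1 : Continuous fun z : Cover σ => z.1.1 := continuous_fst.comp continuous_subtype_val
    have h2 : Continuous fun z : Cover σ => z.1.2 := continuous_snd.comp continuous_subtype_val
    refine Continuous.subtype_mk (Continuous.prodMk ?_ ?_) _
    · refine continuous_pi fun k => ?_
      cases k with
      | zero => exact continuous_const
      | succ k => exact (continuous_apply k).comp h1
    · refine continuous_pi fun k => ?_
      cases k with
      | zero => exact (σ i).continuous.comp ((continuous_apply 0).comp h2)
      | succ k => exact (continuous_apply k).comp h2

end Dynamics

/-! ### The covariance algebra and the tensor algebra norms -/

section TensorAlg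

variable {X : Type u} [TopologicalSpace X] {n : ℕ}

/-- The relations of the covariance algebra: the generators `f ∈ C(X)` form a copy of the unital
algebra `C(X)`, and `f sᵢ = sᵢ (f ∘ σᵢ)`. -/
inductive CovRel (σ : Fin n → C(X, X)) :
    FreeAlgebra ℂ (C(X, ℂ) ⊕ Fin n) → FreeAlgebra ℂ (C(X, ℂ) ⊕ Fin n) → Prop
  | scalar (c : ℂ) :
      CovRel σ (FreeAlgebra.ι ℂ (Sum.inl (algebraMap ℂ C(X, ℂ) c))) (algebraMap ℂ _ c)
  | add (f g : C(X, ℂ)) :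
      CovRel σ (FreeAlgebra.ι ℂ (Sum.inl (f + g)))
        (FreeAlgebra.ι ℂ (Sum.inl f) + FreeAlgebra.ι ℂ (Sum.inl g))
  | mul (f g : C(X, ℂ)) :
      CovRel σ (FreeAlgebra.ι ℂ (Sum.inl (f * g)))
        (FreeAlgebra.ι ℂ (Sum.inl f) * FreeAlgebra.ι ℂ (Sum.inl g))
  | cov (f : C(X, ℂ)) (i : Fin n) :
      CovRel σ (FreeAlgebra.ι ℂ (Sum.inl f) * FreeAlgebra.ι ℂ (Sum.inr i))
        (FreeAlgebra.ι ℂ (Sum.inr i) * FreeAlgebra.ι ℂ (Sum.inl (f.comp (σ i))))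

/-- The covariance algebra `𝒜₀(X, σ)`: polynomials `∑ s_w f_w` in `s₁, …, sₙ` with coefficients
in `C(X)`, multiplied according to `f sᵢ = sᵢ (f ∘ σᵢ)`. -/
abbrev CovAlg (σ : Fin n → C(X, X)) : Type u :=
  RingQuot (CovRel σ)

/-- The coefficient algebra `C(X)` inside the covariance algebra. -/
def coeff (σ : Fin n → C(X, X)) : C(X, ℂ) →ₐ[ℂ] CovAlg σ where
  toFun f := RingQuot.mkAlgHom ℂ (CovRel σ) (FreeAlgebra.ι ℂ (Sum.inl f))
  map_one' := by
    have h := RingQuot.mkAlgHom_rel ℂ (CovRel.scalar (σ := σ) 1)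
    simpa only [map_one] using h
  map_mul' f g := by
    rw [RingQuot.mkAlgHom_rel ℂ (CovRel.mul (σ := σ) f g), map_mul]
  map_zero' := by
    have h := RingQuot.mkAlgHom_rel ℂ (CovRel.scalar (σ := σ) 0)
    simpa only [map_zero] using h
  map_add' f g := by
    rw [RingQuot.mkAlgHom_rel ℂ (CovRel.add (σ := σ) f g), map_add]
  commutes' c := by
    rw [RingQuot.mkAlgHom_rel ℂ (CovRel.scalar (σ := σ) c), AlgHom.commutes]

/-- The generator `sᵢ` of the covariance algebra. -/
def gen (σ : Fin n → C(X, X)) (i : Fin n) : CovAlg σ :=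
  RingQuot.mkAlgHom ℂ (CovRel σ) (FreeAlgebra.ι ℂ (Sum.inr i))

theorem coeff_mul_gen (σ : Fin n → C(X, X)) (f : C(X, ℂ)) (i : Fin n) :
    coeff σ f * gen σ i = gen σ i * coeff σ (f.comp (σ i)) := by
  have h := RingQuot.mkAlgHom_rel ℂ (CovRel.cov (σ := σ) f i)
  rw [map_mul, map_mul] at h
  exact h

/-- Row contractive representations of the covariance algebra on a Hilbert space: the restriction
to `C(X)` is a `*`-homomorphism, and the row operator `[ρ(s₁) ⋯ ρ(sₙ)] : Hⁿ → H` is a contraction. -/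
def IsRowContractive (σ : Fin n → C(X, X)) {H : Type u} [NormedAddCommGroup H]
    [InnerProductSpace ℂ H] [CompleteSpace H] (ρ : CovAlg σ →ₐ[ℂ] (H →L[ℂ] H)) : Prop :=
  (∀ f : C(X, ℂ), ρ (coeff σ (star f)) = star (ρ (coeff σ f))) ∧
    ∀ h : Fin n → H, ‖∑ i, ρ (gen σ i) (h i)‖ ^ 2 ≤ ∑ i, ‖h i‖ ^ 2

/-- The norm of a matrix over the covariance algebra in the tensor algebra `𝒜(X, σ)`: the supremum
of its norms in all row contractive representations. The tensor algebra, as an operator algebra,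
is the completion of the covariance algebra in these matrix norms. -/
def tensorNorm (σ : Fin n → C(X, X)) {m : ℕ} (a : Matrix (Fin m) (Fin m) (CovAlg σ)) : ℝ :=
  sSup {r : ℝ | ∃ (H : Type u) (_ : NormedAddCommGroup H) (_ : InnerProductSpace ℂ H)
    (_ : CompleteSpace H) (ρ : CovAlg σ →ₐ[ℂ] (H →L[ℂ] H)),
      IsRowContractive σ ρ ∧ r = ‖CStarMatrix.ofMatrix (a.map ρ)‖}

/-- A homomorphism of the covariance algebra into a C*-algebra is completely isometric for the
tensor algebra norms (equivalently, it extends to a completely isometric homomorphism of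
`𝒜(X, σ)`). -/
def IsCompletelyIsometric (σ : Fin n → C(X, X)) {D : Type u} [CStarAlgebra D] [PartialOrder D]
    [StarOrderedRing D] (k : CovAlg σ →ₐ[ℂ] D) : Prop :=
  ∀ (m : ℕ) (a : Matrix (Fin m) (Fin m) (CovAlg σ)),
    ‖CStarMatrix.ofMatrix (a.map k)‖ = tensorNorm σ a

/-- A C*-cover of the tensor algebra: a completely isometric homomorphism whose range generates
the C*-algebra. -/
structure IsCStarCover (σ : Fin n → C(X, X)) {D : Type u} [CStarAlgebra D] [PartialOrder D]
    [StarOrderedRing D] (k : CovAlg σ →ₐ[ℂ] D) : Prop where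
  isometric : IsCompletelyIsometric σ k
  generates : (StarAlgebra.adjoin ℂ (Set.range k)).topologicalClosure = ⊤

/-- `j` exhibits `E` as the C*-envelope of the tensor algebra `𝒜(X, σ)`: it is a C*-cover and it
is a quotient of every C*-cover, by a `*`-homomorphism compatible with the embeddings. -/
structure IsCStarEnvelope (σ : Fin n → C(X, X)) {E : Type u} [CStarAlgebra E] [PartialOrder E]
    [StarOrderedRing E] (j : CovAlg σ →ₐ[ℂ] E) : Prop extends IsCStarCover σ j where
  minimal : ∀ (D : Type u) [CStarAlgebra D] [PartialOrder D] [StarOrderedRing D]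
    (k : CovAlg σ →ₐ[ℂ] D), IsCStarCover σ k →
      ∃ q : D →⋆ₐ[ℂ] E, Function.Surjective q ∧ ∀ a, q (k a) = j a

end TensorAlg

/-! ### The algebra `𝔅`, the endomorphism `α`, and invariant ideals -/

section Core

variable {X : Type u} [TopologicalSpace X] {n : ℕ}
variable {E : Type u} [CStarAlgebra E]

/-- `π̃` is a realization of `C(X̃)` in the C*-algebra: it extends the given copy of `C(X)`, where
`f ∈ C(X)` is regarded as `f ∘ p ∈ C(X̃)`, and satisfies the covariance relations
`g tᵢ = tᵢ (g ∘ σ̃ᵢ)` of the covering system, where `tᵢ` is the image of `sᵢ`. -/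
structure IsCoverExtension (σ : Fin n → C(X, X)) (j : CovAlg σ →ₐ[ℂ] E)
    (π : C(Cover σ, ℂ) →⋆ₐ[ℂ] E) : Prop where
  extend : ∀ f : C(X, ℂ), π (f.comp (coverProj σ)) = j (coeff σ f)
  covariant : ∀ (g : C(Cover σ, ℂ)) (i : Fin n),
    π g * j (gen σ i) = j (gen σ i) * π (g.comp (coverMap σ i))

/-- `t_w = t_{i₁} ⋯ t_{iₖ}` for the word `w = i₁ ⋯ iₖ`. -/
def wordElt (σ : Fin n → C(X, X)) (j : CovAlg σ →ₐ[ℂ] E) (w : List (Fin n)) : E :=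
  (w.map fun i => j (gen σ i)).prod

/-- The algebra `𝔅`, the closed linear span of all `t_u f t_v^*` with `|u| = |v|` and
`f ∈ C(X̃)`. -/
def core (σ : Fin n → C(X, X)) (j : CovAlg σ →ₐ[ℂ] E) (π : C(Cover σ, ℂ) →⋆ₐ[ℂ] E) :
    Submodule ℂ E :=
  (Submodule.span ℂ {b : E | ∃ (u v : List (Fin n)) (f : C(Cover σ, ℂ)),
    u.length = v.length ∧ b = wordElt σ j u * π f * star (wordElt σ j v)}).topologicalClosure

/-- The isometry `V = n^{-1/2} (t₁ + ⋯ + tₙ)`. -/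
def isom (σ : Fin n → C(X, X)) (j : CovAlg σ →ₐ[ℂ] E) : E :=
  (((Real.sqrt n)⁻¹ : ℝ) : ℂ) • ∑ i, j (gen σ i)

/-- The map `α(b) = V b V^*`. -/
def endo (σ : Fin n → C(X, X)) (j : CovAlg σ →ₐ[ℂ] E) (b : E) : E :=
  isom σ j * b * star (isom σ j)

/-- `J` is a (closed two-sided) ideal of the closed subalgebra `B`. -/
structure IsIdealOf (B J : Submodule ℂ E) : Prop where
  le : J ≤ B
  closed : IsClosed (J : Set E)
  mul_left : ∀ b ∈ B, ∀ x ∈ J, b * x ∈ J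
  mul_right : ∀ b ∈ B, ∀ x ∈ J, x * b ∈ J

/-- `α(J) ⊆ J`. -/
def IsInvariant (α : E → E) (J : Submodule ℂ E) : Prop :=
  ∀ x ∈ J, α x ∈ J

/-- `α(J) ⊆ J`, and `b ∈ J` whenever `b ∈ B` and `α(b) ∈ J`. -/
def IsBiInvariant (α : E → E) (B J : Submodule ℂ E) : Prop :=
  IsInvariant α J ∧ ∀ b ∈ B, α b ∈ J → b ∈ J

end Core

end MvDyn

end

/-!
Let `ρ` be a row contractive representation. For `r < 1` the Poisson transform of the row
`(r • ρ(𝔰ᵢ))ᵢ` exhibits the rescaled `ρ` as a limit of compressions of Fock matrices over `C(X)`,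
and the values of these matrices at points of `X` are compressions of the orbit representation on
`ℓ²(X̃ × ℤ)`, in which `𝔰ᵢ` acts by the isometry `(z, m) ↦ (σ̃ᵢ z, m + 1)`. Letting `r → 1`, the
orbit representation attains the universal matrix norms. Its isometries satisfy the Cuntz relations
and are covariant for `C(X̃)`, and both facts pass to the envelope, which is a quotient of the
C⋆-algebra they generate. The Cuntz relations force `π(g ∘ shift) = ∑ᵢ 𝔱ᵢ π(g) 𝔱ᵢ*` and send the
indicator of `{i₀ = i}` to `𝔱ᵢ 𝔱ᵢ*`; by Stone–Weierstrass this determines `π`, and `π` is injective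
because `C(X)` embeds in the envelope.

Elements of `𝔅` are limits of matrices over `C(X̃)` in the matrix units `𝔱ᵤ 𝔱ᵥ*`, `|u| = |v|`.
Compressing an element of an ideal by a vector operator `∑ᵤ ξᵤ 𝔱ᵤ` and passing to the limit of the
diagonal parts leads to a function in the ideal, so a nonzero ideal contains a nonzero function. If
the ideal `𝔍` is `α`-invariant, the functions `g` with `𝔱ᵤ g 𝔱ᵤ* ∈ 𝔍` for all `|u| = m` form ideals
increasing with `m`, and minimality together with compactness of `X` produces an invertible function
in one of them. Conversely, a proper nonempty closed invariant `Y ⊆ X` gives the closed set of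
histories staying in `Y`, invariant under the shift and every `σ̃ᵢ`, and the functions vanishing on
it generate a proper bi-invariant ideal.
-/

noncomputable section

namespace MvDyn

section OperatorMatrices

open scoped InnerProductSpace

variable {I : Type*} [Fintype I] {H : Type*} [NormedAddCommGroup H] [InnerProductSpace ℂ H]

/-- The operator on the Hilbert direct sum `H^I` given by a matrix of operators on `H`. -/
def opMatrix (M : CStarMatrix I I (H →L[ℂ] H)) :
    PiLp 2 (fun _ : I => H) →L[ℂ] PiLp 2 (fun _ : I => H) :=
  (PiLp.continuousLinearEquiv 2 ℂ (fun _ : I => H)).symm.toContinuousLinearMap ∘L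
    (ContinuousLinearMap.pi fun i => ∑ k, M i k ∘L PiLp.proj 2 (fun _ : I => H) k)

theorem opMatrix_apply (M : CStarMatrix I I (H →L[ℂ] H)) (ξ : PiLp 2 (fun _ : I => H)) (i : I) :
    opMatrix M ξ i = ∑ k, M i k (ξ k) := by
  simp [opMatrix]

theorem inner_opMatrix (M : CStarMatrix I I (H →L[ℂ] H)) (ξ η : PiLp 2 (fun _ : I => H)) :
    ⟪ξ, opMatrix M η⟫_ℂ = ∑ i, ∑ k, ⟪ξ i, M i k (η k)⟫_ℂ := by
  simp [PiLp.inner_apply, opMatrix_apply, inner_sum]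

theorem norm_le_of_norm_inner_le {K : Type*} [NormedAddCommGroup K] [InnerProductSpace ℂ K]
    {T : H →L[ℂ] K} {C : ℝ} (hC : 0 ≤ C) (h : ∀ ξ η, ‖⟪ξ, T η⟫_ℂ‖ ≤ C * (‖ξ‖ * ‖η‖)) :
    ‖T‖ ≤ C :=
  ContinuousLinearMap.opNorm_le_of_re_inner_le hC fun η ξ hη hξ =>
    calc RCLike.re ⟪T η, ξ⟫_ℂ ≤ ‖⟪T η, ξ⟫_ℂ‖ := RCLike.re_le_norm _
      _ = ‖⟪ξ, T η⟫_ℂ‖ := norm_inner_symm _ _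
      _ ≤ C := by simpa [hη, hξ] using h ξ η

variable [CompleteSpace H]

/-- The identification of operator matrices with operators on the Hilbert direct sum, as a
`*`-homomorphism. -/
def opMatrixHom : CStarMatrix I I (H →L[ℂ] H) →⋆ₙₐ[ℂ]
    (PiLp 2 (fun _ : I => H) →L[ℂ] PiLp 2 (fun _ : I => H)) where
  toFun := opMatrix
  map_smul' c M := by
    ext ξ i
    simp [opMatrix_apply, Finset.smul_sum]
  map_zero' := by
    ext ξ i
    simp [opMatrix_apply]
  map_add' M N := by
    ext ξ i
    simp [opMatrix_apply, Finset.sum_add_distrib]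
  map_mul' M N := by
    ext ξ i
    simp only [opMatrix_apply, CStarMatrix.mul_apply, sum_apply, mul_apply_eq_comp, map_sum]
    rw [Finset.sum_comm]
  map_star' M := by
    rw [ContinuousLinearMap.star_eq_adjoint, ContinuousLinearMap.eq_adjoint_iff]
    intro ξ η
    rw [inner_opMatrix, ← inner_conj_symm, inner_opMatrix, map_sum, Finset.sum_comm]
    simp only [map_sum, inner_conj_symm]
    refine Finset.sum_congr rfl fun i _ => Finset.sum_congr rfl fun k _ => ?_
    rw [CStarMatrix.star_apply, ContinuousLinearMap.star_eq_adjoint,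
      ContinuousLinearMap.adjoint_inner_left]

theorem opMatrixHom_injective :
    Function.Injective (opMatrixHom : CStarMatrix I I (H →L[ℂ] H) →⋆ₙₐ[ℂ] _) := by
  classical
  rw [injective_iff_map_eq_zero]
  intro M hM
  ext i k h
  have := congrArg (fun T => T (WithLp.toLp 2 (Pi.single k h)) i) hM
  simpa [opMatrixHom, opMatrix_apply, Pi.single_apply, apply_ite] using this

theorem norm_opMatrix (M : CStarMatrix I I (H →L[ℂ] H)) : ‖opMatrix M‖ = ‖M‖ :=
  NonUnitalStarAlgHom.norm_map (opMatrixHom : CStarMatrix I I (H →L[ℂ] H) →⋆ₙₐ[ℂ] _)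
    opMatrixHom_injective M

theorem norm_inner_opMatrix_le (M : CStarMatrix I I (H →L[ℂ] H)) (ξ η : PiLp 2 (fun _ : I => H)) :
    ‖⟪ξ, opMatrix M η⟫_ℂ‖ ≤ ‖M‖ * (‖ξ‖ * ‖η‖) :=
  calc ‖⟪ξ, opMatrix M η⟫_ℂ‖ ≤ ‖ξ‖ * ‖opMatrix M η‖ := norm_inner_le_norm _ _
    _ ≤ ‖ξ‖ * (‖opMatrix M‖ * ‖η‖) := by gcongr; exact ContinuousLinearMap.le_opNorm _ _
    _ = ‖M‖ * (‖ξ‖ * ‖η‖) := by rw [norm_opMatrix]; ring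

theorem star_inner_right (S : H →L[ℂ] H) (x y : H) : ⟪x, S y⟫_ℂ = ⟪star S x, y⟫_ℂ := by
  rw [ContinuousLinearMap.star_eq_adjoint, ContinuousLinearMap.adjoint_inner_left]

theorem sum_norm_sq_eq_inner (D : I → H →L[ℂ] H) (ξ : H) :
    ((∑ i, ‖D i ξ‖ ^ 2 : ℝ) : ℂ) = ⟪ξ, (∑ i, star (D i) * D i) ξ⟫_ℂ := by
  simp only [sum_apply, inner_sum, mul_apply_eq_comp, star_inner_right (star _), star_star]
  push_cast
  exact Finset.sum_congr rfl fun i _ => (inner_self_eq_norm_sq_to_K (𝕜 := ℂ) (D i ξ)).symm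

theorem sum_star_mul_self_le_one_iff {D : I → H →L[ℂ] H} :
    ∑ i, star (D i) * D i ≤ 1 ↔ ∀ ξ, ∑ i, ‖D i ξ‖ ^ 2 ≤ ‖ξ‖ ^ 2 := by
  rw [ContinuousLinearMap.le_def, ContinuousLinearMap.isPositive_iff_complex]
  refine forall_congr' fun ξ => ?_
  have h : ⟪(1 - ∑ i, star (D i) * D i) ξ, ξ⟫_ℂ =
      ((‖ξ‖ ^ 2 - ∑ i, ‖D i ξ‖ ^ 2 : ℝ) : ℂ) := by
    rw [sub_apply, inner_sub_left, one_apply_eq_self, inner_self_eq_norm_sq_to_K,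
      ← inner_conj_symm _ ξ, ← sum_norm_sq_eq_inner, Complex.conj_ofReal]
    push_cast
    rfl
  rw [h]
  exact (and_iff_right rfl).trans sub_nonneg

theorem norm_compression_le {J : Type*} [Fintype J] {D : J → H →L[ℂ] H}
    (hD : ∑ u, star (D u) * D u ≤ 1) (N : CStarMatrix (J × I) (J × I) (H →L[ℂ] H)) :
    ‖CStarMatrix.ofMatrix (Matrix.of fun k l => ∑ u, ∑ v, star (D u) * N (u, k) (v, l) * D v)‖ ≤
      ‖N‖ := by
  let column : PiLp 2 (fun _ : I => H) → PiLp 2 (fun _ : J × I => H) :=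
    fun ζ => WithLp.toLp 2 fun i => D i.1 (ζ i.2)
  have norm_column : ∀ ζ, ‖column ζ‖ ≤ ‖ζ‖ := fun ζ => by
    rw [PiLp.norm_eq_of_L2, PiLp.norm_eq_of_L2, Fintype.sum_prod_type, Finset.sum_comm]
    exact Real.sqrt_le_sqrt
      (Finset.sum_le_sum fun k _ => sum_star_mul_self_le_one_iff.mp hD (ζ k))
  rw [← norm_opMatrix]
  refine norm_le_of_norm_inner_le (norm_nonneg _) fun ξ η => ?_
  have inner_column : ∀ k l, ⟪ξ k, (∑ u, ∑ v, star (D u) * N (u, k) (v, l) * D v) (η l)⟫_ℂ =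
      ∑ u, ∑ v, ⟪column ξ (u, k), N (u, k) (v, l) (column η (v, l))⟫_ℂ := fun k l => by
    simp [column, sum_apply, star_inner_right (star _), mul_assoc]
  calc _ = ‖⟪column ξ, opMatrix N (column η)⟫_ℂ‖ := by
        rw [inner_opMatrix, inner_opMatrix]
        refine congrArg _ ((Finset.sum_congr rfl fun k _ =>
          Finset.sum_congr rfl fun l _ => inner_column k l).trans ?_)
        simp only [Fintype.sum_prod_type]
        conv_rhs => rw [Finset.sum_comm]
        exact Finset.sum_congr rfl fun k _ => Finset.sum_comm.trans
          (Finset.sum_congr rfl fun u _ => Finset.sum_comm)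
    _ ≤ ‖N‖ * (‖column ξ‖ * ‖column η‖) := norm_inner_opMatrix_le N _ _
    _ ≤ ‖N‖ * (‖ξ‖ * ‖η‖) := by gcongr <;> exact norm_column _

theorem norm_scalarCompression_le {J : Type*} [Fintype J] [DecidableEq I] [DecidableEq J]
    {e : J → H} (he : Orthonormal ℂ e) (M : CStarMatrix I I (H →L[ℂ] H)) :
    ‖Matrix.toEuclideanCLM (n := J × I) (𝕜 := ℂ)
      (Matrix.of fun i j => ⟪e i.1, M i.2 j.2 (e j.1)⟫_ℂ)‖ ≤ ‖M‖ := by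
  let lift : EuclideanSpace ℂ (J × I) → PiLp 2 (fun _ : I => H) :=
    fun ζ => WithLp.toLp 2 fun k => ∑ v, ζ (v, k) • e v
  have norm_lift : ∀ ζ, ‖lift ζ‖ = ‖ζ‖ := fun ζ => by
    rw [PiLp.norm_eq_of_L2, EuclideanSpace.norm_eq, Fintype.sum_prod_type, Finset.sum_comm]
    congr 1
    refine Finset.sum_congr rfl fun k _ => Complex.ofReal_injective ?_
    have h := he.inner_sum (fun v => ζ (v, k)) (fun v => ζ (v, k)) Finset.univ
    rw [inner_self_eq_norm_sq_to_K] at h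
    simp only [Complex.conj_mul'] at h
    push_cast
    exact h
  refine norm_le_of_norm_inner_le (norm_nonneg _) fun ξ η => ?_
  have inner_lift : ∀ k l, ⟪lift ξ k, M k l (lift η l)⟫_ℂ =
      ∑ u, ∑ v, star (ξ (u, k)) * (⟪e u, M k l (e v)⟫_ℂ * η (v, l)) := fun k l => by
    simp only [lift, map_sum, map_smul, sum_inner, inner_sum, inner_smul_left, inner_smul_right]
    rw [Finset.sum_comm]
    simp only [Finset.mul_sum]
    refine Finset.sum_congr rfl fun u _ => Finset.sum_congr rfl fun v _ => ?_
    rw [mul_left_comm, mul_comm (η _)]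
    rfl
  calc _ = ‖⟪lift ξ, opMatrix M (lift η)⟫_ℂ‖ := by
        rw [inner_opMatrix]
        simp only [inner_lift, PiLp.inner_apply, Fintype.sum_prod_type,
          Matrix.ofLp_toEuclideanCLM, Matrix.mulVec, dotProduct, RCLike.inner_apply',
          Finset.mul_sum]
        rw [Finset.sum_comm]
        refine congrArg _ ?_
        refine Finset.sum_congr rfl fun k _ => Eq.trans ?_ Finset.sum_comm
        exact Finset.sum_congr rfl fun u _ => Finset.sum_comm
    _ ≤ ‖M‖ * (‖lift ξ‖ * ‖lift η‖) := norm_inner_opMatrix_le M _ _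
    _ = ‖M‖ * (‖ξ‖ * ‖η‖) := by rw [norm_lift, norm_lift]

end OperatorMatrices

section FunctionMatrices

variable {I : Type*} [Fintype I] [DecidableEq I] {Y : Type*} [TopologicalSpace Y]

/-- The value at `y` of a matrix of continuous functions, as an operator on Euclidean space. -/
def evalMatrix (y : Y) : CStarMatrix I I C(Y, ℂ) →⋆ₙₐ[ℂ]
    (EuclideanSpace ℂ I →L[ℂ] EuclideanSpace ℂ I) :=
  ((Matrix.toEuclideanCLM (n := I) (𝕜 := ℂ)).toStarAlgHom : Matrix I I ℂ →⋆ₙₐ[ℂ] _).comp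
    { toFun := fun A => Matrix.of fun i k => A i k y
      map_smul' := fun _ _ => rfl
      map_zero' := rfl
      map_add' := fun _ _ => rfl
      map_mul' := fun A B => by
        ext i k
        simp [CStarMatrix.mul_apply, Matrix.mul_apply]
      map_star' := fun _ => rfl }

theorem evalMatrix_apply (y : Y) (A : CStarMatrix I I C(Y, ℂ)) :
    evalMatrix y A = Matrix.toEuclideanCLM (n := I) (𝕜 := ℂ) (Matrix.of fun i k => A i k y) :=
  rfl

theorem continuous_evalMatrix (A : CStarMatrix I I C(Y, ℂ)) :
    Continuous fun y => evalMatrix y A :=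
  (Matrix.toEuclideanCLM (n := I) (𝕜 := ℂ)).toAlgEquiv.toLinearMap.continuous_of_finiteDimensional
    |>.comp (continuous_matrix fun i k => (A i k).continuous)

theorem eq_zero_of_evalMatrix_eq_zero {A : CStarMatrix I I C(Y, ℂ)}
    (h : ∀ y, evalMatrix y A = 0) : A = 0 := by
  ext i k y
  have hy := (map_eq_zero_iff _ (Matrix.toEuclideanCLM (n := I) (𝕜 := ℂ)).injective).mp (h y)
  exact congrFun (congrFun hy i) k

variable [CompactSpace Y]

/-- A matrix of continuous functions on `Y` as an operator valued continuous function. -/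
def evalMatrixHom :
    CStarMatrix I I C(Y, ℂ) →⋆ₙₐ[ℂ] C(Y, EuclideanSpace ℂ I →L[ℂ] EuclideanSpace ℂ I) where
  toFun A := ⟨fun y => evalMatrix y A, continuous_evalMatrix A⟩
  map_smul' c A := ContinuousMap.ext fun y => map_smul (evalMatrix y) c A
  map_zero' := ContinuousMap.ext fun y => map_zero (evalMatrix y)
  map_add' A B := ContinuousMap.ext fun y => map_add (evalMatrix y) A B
  map_mul' A B := ContinuousMap.ext fun y => map_mul (evalMatrix y) A B
  map_star' A := ContinuousMap.ext fun y => map_star (evalMatrix y) A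

theorem norm_map_le_of_evalMatrix_le {B : Type*} [CStarAlgebra B]
    (ψ : CStarMatrix I I C(Y, ℂ) →⋆ₙₐ[ℂ] B) (A : CStarMatrix I I C(Y, ℂ)) {C : ℝ} (hC : 0 ≤ C)
    (h : ∀ y, ‖evalMatrix y A‖ ≤ C) : ‖ψ A‖ ≤ C := by
  let _ : PartialOrder C(Y, ℂ) := CStarAlgebra.spectralOrder _
  have _ : StarOrderedRing C(Y, ℂ) := CStarAlgebra.spectralOrderedRing _
  have injective : Function.Injective (evalMatrixHom : CStarMatrix I I C(Y, ℂ) →⋆ₙₐ[ℂ] _) := by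
    rw [injective_iff_map_eq_zero]
    exact fun M hM => eq_zero_of_evalMatrix_eq_zero fun y => DFunLike.congr_fun hM y
  calc ‖ψ A‖ ≤ ‖A‖ := NonUnitalStarAlgHom.norm_apply_le ψ A
    _ = ‖evalMatrixHom A‖ := (NonUnitalStarAlgHom.norm_map _ injective A).symm
    _ ≤ C := (ContinuousMap.norm_le _ hC).mpr h

end FunctionMatrices

theorem tendsto_ofMatrix {I A α : Type*} [NonUnitalCStarAlgebra A] {l : Filter α}
    {F : α → Matrix I I A} {G : Matrix I I A}
    (h : ∀ i k, Filter.Tendsto (fun x => F x i k) l (nhds (G i k))) :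
    Filter.Tendsto (fun x => CStarMatrix.ofMatrix (F x)) l (nhds (CStarMatrix.ofMatrix G)) :=
  tendsto_pi_nhds.mpr fun i => tendsto_pi_nhds.mpr fun k => h i k

section Words

/-- Prepending a letter to a word. -/
def consEmbedding (n : ℕ) : Fin n × List (Fin n) ↪ List (Fin n) where
  toFun p := p.1 :: p.2
  inj' p q h := by simpa [Prod.ext_iff] using h

theorem consEmbedding_apply {n : ℕ} (p : Fin n × List (Fin n)) :
    consEmbedding n p = p.1 :: p.2 := rfl

/-- The words of length `k` in the letters `0, …, n - 1`. -/
def words (n : ℕ) : ℕ → Finset (List (Fin n))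
  | 0 => {[]}
  | k + 1 => (Finset.univ ×ˢ words n k).map (consEmbedding n)

/-- The words of length less than `M` in the letters `0, …, n - 1`. -/
def wordsBelow (n M : ℕ) : Finset (List (Fin n)) := (Finset.range M).biUnion (words n)

variable {n : ℕ}

theorem mem_words {k : ℕ} {w : List (Fin n)} : w ∈ words n k ↔ w.length = k := by
  induction k generalizing w with
  | zero => simp [words]
  | succ k ih => cases w <;> simp [words, consEmbedding_apply, ih]

theorem mem_wordsBelow {M : ℕ} {w : List (Fin n)} : w ∈ wordsBelow n M ↔ w.length < M := by
  simp [wordsBelow, mem_words]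

theorem sum_words_zero {M : Type*} [AddCommMonoid M] (F : List (Fin n) → M) :
    ∑ w ∈ words n 0, F w = F [] := by simp [words]

theorem sum_words_succ {M : Type*} [AddCommMonoid M] (k : ℕ) (F : List (Fin n) → M) :
    ∑ w ∈ words n (k + 1), F w = ∑ i, ∑ w ∈ words n k, F (i :: w) := by
  simp [words, consEmbedding_apply, Finset.sum_product]

theorem sum_wordsBelow {R : Type*} [AddCommMonoid R] (M : ℕ) (F : List (Fin n) → R) :
    ∑ w ∈ wordsBelow n M, F w = ∑ k ∈ Finset.range M, ∑ w ∈ words n k, F w := by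
  refine Finset.sum_biUnion fun k _ l _ hkl => ?_
  refine Finset.disjoint_left.mpr fun w hw hw' => hkl ?_
  rw [← mem_words.mp hw, ← mem_words.mp hw']

end Words

section WordProducts

variable {A : Type*} {n : ℕ}

/-- The product `t_w = t_{i₁} ⋯ t_{iₖ}` along the word `w = i₁ ⋯ iₖ`. -/
def wordProd [Monoid A] (t : Fin n → A) (w : List (Fin n)) : A := (w.map t).prod

@[simp] theorem wordProd_nil [Monoid A] (t : Fin n → A) : wordProd t [] = 1 := rfl

@[simp] theorem wordProd_cons [Monoid A] (t : Fin n → A) (i : Fin n) (w : List (Fin n)) :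
    wordProd t (i :: w) = t i * wordProd t w := by simp [wordProd]

theorem wordProd_append [Monoid A] (t : Fin n → A) (v w : List (Fin n)) :
    wordProd t (v ++ w) = wordProd t v * wordProd t w := by simp [wordProd]

theorem map_wordProd {B F : Type*} [Monoid A] [Monoid B] [FunLike F A B] [MonoidHomClass F A B]
    (ρ : F) (t : Fin n → A) (w : List (Fin n)) :
    ρ (wordProd t w) = wordProd (fun i => ρ (t i)) w := by
  induction w with
  | nil => simp
  | cons i w ih => rw [wordProd_cons, map_mul, ih, wordProd_cons]

theorem wordProd_smul {R : Type*} [CommMonoid R] [Monoid A] [MulAction R A]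
    [IsScalarTower R A A] [SMulCommClass R A A] (r : R) (t : Fin n → A) (w : List (Fin n)) :
    wordProd (r • t) w = r ^ w.length • wordProd t w := by
  induction w with
  | nil => simp
  | cons i w ih =>
    rw [wordProd_cons, wordProd_cons, ih, Pi.smul_apply, smul_mul_smul_comm, List.length_cons,
      pow_succ']

variable [Ring A] [StarRing A]

/-- The map `b ↦ ∑ᵢ tᵢ b tᵢ^*` associated with the row `t`. -/
def rowConj (t : Fin n → A) : A →+ A where
  toFun b := ∑ i, t i * b * star (t i)
  map_zero' := by simp
  map_add' a b := by simp [mul_add, add_mul, Finset.sum_add_distrib]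

theorem rowConj_apply (t : Fin n → A) (b : A) : rowConj t b = ∑ i, t i * b * star (t i) := rfl

theorem rowConj_iterate (t : Fin n → A) (k : ℕ) (b : A) :
    (rowConj t)^[k] b = ∑ w ∈ words n k, wordProd t w * b * star (wordProd t w) := by
  induction k with
  | zero => simp [sum_words_zero]
  | succ k ih =>
    simp only [Function.iterate_succ_apply', ih, rowConj_apply, sum_words_succ, Finset.mul_sum,
      Finset.sum_mul, wordProd_cons, star_mul, mul_assoc]

end WordProducts

section Covariance

variable {Y : Type*} [TopologicalSpace Y] {n : ℕ}

/-- The composition `τ_w = τ_{i₁} ∘ ⋯ ∘ τ_{iₖ}`, bundled as a continuous map. -/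
def wordComp (τ : Fin n → C(Y, Y)) : List (Fin n) → C(Y, Y)
  | [] => ContinuousMap.id Y
  | i :: w => (τ i).comp (wordComp τ w)

theorem wordComp_apply {X : Type u} [TopologicalSpace X] (τ : Fin n → C(X, X))
    (w : List (Fin n)) (x : X) : wordComp τ w x = wordMap τ w x := by
  induction w with
  | nil => rfl
  | cons i w ih => exact congrArg (τ i) ih

theorem wordComp_append (τ : Fin n → C(Y, Y)) (v w : List (Fin n)) :
    wordComp τ (v ++ w) = (wordComp τ v).comp (wordComp τ w) := by
  induction v with
  | nil => rfl
  | cons i v ih => rw [List.cons_append, wordComp, ih]; rfl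

/-- The covariance relations `φ(f) sᵢ = sᵢ φ(f ∘ τᵢ)` between a map `φ` on the functions on `Y`
and a row of elements `sᵢ`. -/
def IsCovariant {A : Type*} [Mul A] (τ : Fin n → C(Y, Y)) (φ : C(Y, ℂ) → A) (s : Fin n → A) :
    Prop :=
  ∀ f i, φ f * s i = s i * φ (f.comp (τ i))

variable {A : Type*} {τ : Fin n → C(Y, Y)} {s : Fin n → A}

theorem IsCovariant.mul_wordProd [Monoid A] {φ : C(Y, ℂ) → A} (h : IsCovariant τ φ s)
    (f : C(Y, ℂ)) (w : List (Fin n)) :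
    φ f * wordProd s w = wordProd s w * φ (f.comp (wordComp τ w)) := by
  induction w generalizing f with
  | nil => simp [wordComp]
  | cons i w ih => rw [wordProd_cons, ← mul_assoc, h, mul_assoc, ih, ← mul_assoc]; rfl

variable [Ring A] [StarRing A] [Algebra ℂ A] {φ : C(Y, ℂ) →⋆ₐ[ℂ] A}

theorem IsCovariant.star_wordProd_mul (h : IsCovariant τ φ s) (f : C(Y, ℂ)) (w : List (Fin n)) :
    star (wordProd s w) * φ f = φ (f.comp (wordComp τ w)) * star (wordProd s w) := by
  have hcomp : star ((star f).comp (wordComp τ w)) = f.comp (wordComp τ w) := by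
    ext
    simp
  have hstar := congrArg star (h.mul_wordProd (star f) w)
  rwa [star_mul, star_mul, ← map_star, ← map_star, star_star, hcomp] at hstar

theorem IsCovariant.star_row_mul (h : IsCovariant τ φ s) (f : C(Y, ℂ)) (i : Fin n) :
    star (s i) * φ f = φ (f.comp (τ i)) * star (s i) := by
  simpa [wordComp] using h.star_wordProd_mul f [i]

theorem IsCovariant.commute_rowConj_one (h : IsCovariant τ φ s) (f : C(Y, ℂ)) :
    Commute (rowConj s 1) (φ f) := by
  rw [commute_iff_eq, rowConj_apply, Finset.sum_mul, Finset.mul_sum]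
  refine Finset.sum_congr rfl fun i _ => ?_
  rw [mul_one, mul_assoc, h.star_row_mul, ← mul_assoc, ← mul_assoc, h]

end Covariance

section CoverSpace

variable {X : Type u} [TopologicalSpace X] {n : ℕ} {σ : Fin n → C(X, X)}

theorem Cover.ext {z z' : Cover σ} (hindex : ∀ k, z.1.1 k = z'.1.1 k)
    (hpoint : ∀ k, z.1.2 k = z'.1.2 k) : z = z' :=
  Subtype.ext (Prod.ext (funext hindex) (funext hpoint))

theorem Cover.continuous_index (k : ℕ) : Continuous fun z : Cover σ => z.1.1 k :=
  (continuous_apply k).comp (continuous_fst.comp continuous_subtype_val)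

theorem Cover.continuous_point (k : ℕ) : Continuous fun z : Cover σ => z.1.2 k :=
  (continuous_apply k).comp (continuous_snd.comp continuous_subtype_val)

instance [T2Space X] : T2Space (Cover σ) :=
  inferInstanceAs (T2Space
    {z : (ℕ → Fin n) × (ℕ → X) // ∀ k, σ (z.1 k) (z.2 (k + 1)) = z.2 k})

instance [CompactSpace X] [T2Space X] : CompactSpace (Cover σ) := by
  have isClosed_relation (k : ℕ) :
      IsClosed {z : (ℕ → Fin n) × (ℕ → X) | σ (z.1 k) (z.2 (k + 1)) = z.2 k} := by
    have h : {z : (ℕ → Fin n) × (ℕ → X) | σ (z.1 k) (z.2 (k + 1)) = z.2 k} =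
        ⋃ i : Fin n, {z | z.1 k = i} ∩ {z | σ i (z.2 (k + 1)) = z.2 k} := by
      ext z
      simp
    rw [h]
    exact isClosed_iUnion_of_finite fun i =>
      (isClosed_eq (by fun_prop) continuous_const).inter (isClosed_eq (by fun_prop) (by fun_prop))
  have isClosed_cover : IsClosed
      {z : (ℕ → Fin n) × (ℕ → X) | ∀ k, σ (z.1 k) (z.2 (k + 1)) = z.2 k} := by
    rw [Set.ofPred_forall]
    exact isClosed_iInter isClosed_relation
  exact isCompact_iff_compactSpace.mp isClosed_cover.isCompact

/-- The first index `i₀` of a point of the covering space. -/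
def firstIndex (z : Cover σ) : Fin n := z.1.1 0

/-- The shift `((i₀, i₁, …), (x₀, x₁, …)) ↦ ((i₁, i₂, …), (x₁, x₂, …))`, a common left inverse of
the maps `σ̃ᵢ`. -/
def shift (σ : Fin n → C(X, X)) : C(Cover σ, Cover σ) where
  toFun z := ⟨(fun k => z.1.1 (k + 1), fun k => z.1.2 (k + 1)), fun k => z.2 (k + 1)⟩
  continuous_toFun := Continuous.subtype_mk (Continuous.prodMk
    (continuous_pi fun _ => Cover.continuous_index _)
    (continuous_pi fun _ => Cover.continuous_point _)) _

theorem coverMap_firstIndex (z : Cover σ) : coverMap σ (firstIndex z) (shift σ z) = z := by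
  refine Cover.ext (fun k => ?_) (fun k => ?_) <;> cases k
  · rfl
  · rfl
  · exact z.2 0
  · rfl

theorem coverProj_wordComp (w : List (Fin n)) (z : Cover σ) :
    coverProj σ (wordComp (coverMap σ) w z) = wordComp σ w (coverProj σ z) := by
  induction w with
  | nil => rfl
  | cons i w ih => exact congrArg (σ i) ih

theorem coverProj_iterate_shift (k : ℕ) (z : Cover σ) :
    coverProj σ ((shift σ)^[k] z) = z.1.2 k := by
  induction k generalizing z with
  | zero => rfl
  | succ k ih => rw [Function.iterate_succ_apply, ih]; rfl

theorem firstIndex_iterate_shift (k : ℕ) (z : Cover σ) :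
    firstIndex ((shift σ)^[k] z) = z.1.1 k := by
  induction k generalizing z with
  | zero => rfl
  | succ k ih => rw [Function.iterate_succ_apply, ih]; rfl

theorem iterate_shift_wordComp (w : List (Fin n)) (z : Cover σ) :
    (shift σ)^[w.length] (wordComp (coverMap σ) w z) = z := by
  induction w with
  | nil => rfl
  | cons _ _ ih => exact ih

theorem index_wordComp (w : List (Fin n)) (z : Cover σ) {k : ℕ} (hk : k < w.length) :
    (wordComp (coverMap σ) w z).1.1 k = w[k] := by
  induction w generalizing k with
  | nil => exact absurd hk (Nat.not_lt_zero k)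
  | cons i w ih =>
    cases k with
    | zero => rfl
    | succ k => exact ih (Nat.lt_of_succ_lt_succ hk)

theorem wordComp_coverMap_inj {v w : List (Fin n)} (h : v.length = w.length) {z z' : Cover σ}
    (e : wordComp (coverMap σ) v z = wordComp (coverMap σ) w z') : v = w ∧ z = z' := by
  constructor
  · refine List.ext_getElem h fun k hv hw => ?_
    rw [← index_wordComp v z hv, ← index_wordComp w z' hw, e]
  · rw [← iterate_shift_wordComp v z, ← iterate_shift_wordComp w z', e, h]

theorem exists_wordComp_iterate_shift (k : ℕ) (z : Cover σ) :
    ∃ w : List (Fin n), w.length = k ∧ wordComp (coverMap σ) w ((shift σ)^[k] z) = z := by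
  induction k generalizing z with
  | zero => exact ⟨[], rfl, rfl⟩
  | succ k ih =>
    obtain ⟨w, hw, e⟩ := ih (shift σ z)
    exact ⟨firstIndex z :: w, by simp [hw],
      (congrArg (coverMap σ _) e).trans (coverMap_firstIndex z)⟩

theorem coverProj_surjective (hσ : IsSurjective σ) : Function.Surjective (coverProj σ) := by
  have exists_preimage (x : X) : ∃ q : Fin n × X, σ q.1 q.2 = x := by
    obtain ⟨i, y, hy⟩ := Set.mem_iUnion.mp (hσ.symm ▸ Set.mem_univ x)
    exact ⟨(i, y), hy⟩
  choose pre hpre using exists_preimage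
  intro x
  let point : ℕ → X := fun k => (fun y => (pre y).2)^[k] x
  refine ⟨⟨(fun k => (pre (point k)).1, point), fun k => ?_⟩, rfl⟩
  have point_succ : point (k + 1) = (pre (point k)).2 := Function.iterate_succ_apply' _ _ _
  simpa only [point_succ] using hpre (point k)

end CoverSpace

section Separation

variable {Y : Type*} [TopologicalSpace Y]

theorem exists_complex_continuousMap_ne [NormalSpace Y] [T1Space Y]
    {x y : Y} (h : x ≠ y) : ∃ f : C(Y, ℂ), f x ≠ f y := by
  obtain ⟨f, hf0, hf1, -⟩ := exists_continuous_zero_one_of_isClosed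
    (isClosed_singleton (x := x)) (isClosed_singleton (x := y)) (by simpa using h)
  refine ⟨.comp ⟨Complex.ofReal, Complex.continuous_ofReal⟩ f, ?_⟩
  simp [hf0 (Set.mem_singleton x), hf1 (Set.mem_singleton y)]

theorem exists_mul_eq_ofReal (g : C(Y, ℂ)) (f : C(Y, ℝ))
    {c : ℝ} (hc : 0 < c) (hg : ∀ y, f y ≠ 0 → c ≤ ‖g y‖ ^ 2) :
    ∃ h : C(Y, ℂ), ∀ y, h y * g y = f y := by
  have hden (y : Y) : max (‖g y‖ ^ 2) c ≠ 0 := (lt_max_of_lt_right hc).ne'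
  refine ⟨⟨fun y => f y * star (g y) / (max (‖g y‖ ^ 2) c : ℝ), ?_⟩, fun y => ?_⟩
  · exact Continuous.div (by fun_prop) (by fun_prop) fun y => by exact_mod_cast hden y
  · change (f y : ℂ) * star (g y) / (max (‖g y‖ ^ 2) c : ℝ) * g y = f y
    by_cases hy : f y = 0
    · simp [hy]
    · have hmax := max_eq_left (hg y hy)
      have hne : ((‖g y‖ ^ 2 : ℝ) : ℂ) ≠ 0 := by exact_mod_cast hmax ▸ hden y
      have hconj : star (g y) * g y = ((‖g y‖ ^ 2 : ℝ) : ℂ) := by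
        rw [Complex.ofReal_pow]
        exact Complex.conj_mul' (g y)
      rw [hmax, div_mul_eq_mul_div, mul_assoc, hconj, mul_div_cancel_right₀ _ hne]

end Separation

section CoverFunctions

variable {X : Type u} [TopologicalSpace X] {n : ℕ} {σ : Fin n → C(X, X)}

/-- The indicator function of the set of points of the covering space with first index `i`. -/
def indexIndicator (σ : Fin n → C(X, X)) (i : Fin n) : C(Cover σ, ℂ) where
  toFun z := if firstIndex z = i then 1 else 0
  continuous_toFun :=
    (continuous_of_discreteTopology (f := fun k : Fin n => if k = i then (1 : ℂ) else 0)).comp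
      (Cover.continuous_index 0)

theorem indexIndicator_comp_coverMap (i k : Fin n) :
    (indexIndicator σ i).comp (coverMap σ k) = if k = i then 1 else 0 := by
  ext z
  change (if k = i then (1 : ℂ) else 0) = _
  split_ifs <;> rfl

variable [CompactSpace X] [T2Space X]

theorem starSubalgebra_cover_eq_top (S : StarSubalgebra ℂ C(Cover σ, ℂ))
    (hS : IsClosed (S : Set C(Cover σ, ℂ))) (hproj : ∀ f : C(X, ℂ), f.comp (coverProj σ) ∈ S)
    (hindex : ∀ i, indexIndicator σ i ∈ S) (hshift : ∀ g ∈ S, g.comp (shift σ) ∈ S) : S = ⊤ := by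
  have separatesPoints : S.SeparatesPoints := by
    intro z z' hne
    by_contra hcon
    have agree (k : ℕ) : ∀ g ∈ S, g ((shift σ)^[k] z) = g ((shift σ)^[k] z') := by
      induction k with
      | zero => exact fun g hg => by_contra fun h => hcon ⟨g, ⟨g, hg, rfl⟩, h⟩
      | succ k ih =>
        simp only [Function.iterate_succ_apply']
        exact fun g hg => ih _ (hshift g hg)
    refine hne (Cover.ext (fun k => ?_) (fun k => ?_))
    · have h := agree k _ (hindex (z'.1.1 k))
      change (if firstIndex _ = _ then (1 : ℂ) else 0) = if firstIndex _ = _ then 1 else 0 at h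
      simpa [firstIndex_iterate_shift] using h
    · by_contra h
      obtain ⟨f, hf⟩ := exists_complex_continuousMap_ne h
      have := agree k _ (hproj f)
      simp only [ContinuousMap.comp_apply, coverProj_iterate_shift] at this
      exact hf this
  have := ContinuousMap.starSubalgebra_topologicalClosure_eq_top_of_separatesPoints S
    separatesPoints
  exact top_unique (this ▸ S.topologicalClosure_minimal le_rfl hS)

theorem exists_forall_agree_mem {U : Set (Cover σ)} (hU : IsOpen U) {z : Cover σ} (hz : z ∈ U) :
    ∃ k, ∀ y : Cover σ, y.1.2 k = z.1.2 k → (∀ m < k, y.1.1 m = z.1.1 m) → y ∈ U := by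
  let agree : ℕ → Set (Cover σ) := fun k =>
    {y | y.1.2 k = z.1.2 k} ∩ ⋂ m, ⋂ (_ : m < k), {y | y.1.1 m = z.1.1 m}
  have mem_agree {k y} : y ∈ agree k ↔ y.1.2 k = z.1.2 k ∧ ∀ m < k, y.1.1 m = z.1.1 m := by
    simp [agree]
  have isClosed_agree (k : ℕ) : IsClosed (agree k) :=
    (isClosed_eq (Cover.continuous_point k) continuous_const).inter <|
      isClosed_iInter fun m => isClosed_iInter fun _ =>
        isClosed_eq (Cover.continuous_index m) continuous_const
  have agree_succ_subset (k : ℕ) : agree (k + 1) ⊆ agree k := fun y hy => by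
    obtain ⟨hpoint, hindex⟩ := mem_agree.mp hy
    refine mem_agree.mpr ⟨?_, fun m hm => hindex m (by omega)⟩
    rw [← y.2 k, ← z.2 k, hpoint, hindex k (by omega)]
  have iInter_agree_subset : ⋂ k, agree k ⊆ {z} := fun y hy => by
    have h k := mem_agree.mp (Set.mem_iInter.mp hy k)
    exact Cover.ext (fun k => (h (k + 1)).2 k (by omega)) (fun k => (h k).1)
  obtain ⟨k, hk⟩ := exists_subset_nhds_of_compactSpace (V := agree)
    (antitone_nat_of_succ_le agree_succ_subset).directed_ge isClosed_agree
    fun y hy => hU.mem_nhds (iInter_agree_subset hy ▸ hz)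
  exact ⟨k, fun y hpoint hindex => hk (mem_agree.mpr ⟨hpoint, hindex⟩)⟩

theorem exists_wordComp_mem {U : Set (Cover σ)} (hU : IsOpen U) {z : Cover σ} (hz : z ∈ U) :
    ∃ (w : List (Fin n)) (x : X) (O : Set X), IsOpen O ∧ x ∈ O ∧
      ∀ y : Cover σ, coverProj σ y ∈ O → wordComp (coverMap σ) w y ∈ U := by
  obtain ⟨k, hk⟩ := exists_forall_agree_mem hU hz
  obtain ⟨w, rfl, hw⟩ := exists_wordComp_iterate_shift k z
  have fiber_mem (y : Cover σ) (hy : coverProj σ y = z.1.2 w.length) :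
      wordComp (coverMap σ) w y ∈ U := by
    refine hk _ ?_ fun m hm => ?_
    · rw [← coverProj_iterate_shift, iterate_shift_wordComp, hy]
    · rw [← hw, index_wordComp _ _ hm, index_wordComp _ _ hm]
  refine ⟨w, z.1.2 w.length, (coverProj σ '' (wordComp (coverMap σ) w ⁻¹' U)ᶜ)ᶜ, ?_, ?_, ?_⟩
  · rw [isOpen_compl_iff]
    exact ((hU.preimage (wordComp (coverMap σ) w).continuous).isClosed_compl.isCompact.image
      (coverProj σ).continuous).isClosed
  · rintro ⟨y, hy, hyz⟩
    exact hy (fiber_mem y hyz)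
  · intro y hy
    by_contra h
    exact hy ⟨y, h, rfl⟩

theorem exists_mul_comp_wordComp {g : C(Cover σ, ℂ)} (hg : g ≠ 0) :
    ∃ (w : List (Fin n)) (f : C(X, ℝ)) (h : C(Cover σ, ℂ)), (∀ x, 0 ≤ f x) ∧ (∃ x, f x = 1) ∧
      ∀ y, h y * g (wordComp (coverMap σ) w y) = f (coverProj σ y) := by
  obtain ⟨z, hz⟩ := DFunLike.ne_iff.mp hg
  have hpos : 0 < ‖g z‖ ^ 2 := by
    have := norm_pos_iff.mpr hz
    positivity
  obtain ⟨w, x, O, hO, hxO, hw⟩ := exists_wordComp_mem (U := {y | ‖g z‖ ^ 2 / 2 < ‖g y‖ ^ 2})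
    (isOpen_lt continuous_const (by fun_prop)) (z := z) (half_lt_self hpos)
  obtain ⟨f, hf0, hf1, hf⟩ := exists_continuous_zero_one_of_isClosed
    hO.isClosed_compl (isClosed_singleton (x := x)) (by simpa using hxO)
  obtain ⟨h, hh⟩ := exists_mul_eq_ofReal (g.comp (wordComp (coverMap σ) w))
    (f.comp (coverProj σ)) (half_pos hpos)
    fun y hy => (hw y (by_contra fun h => hy (hf0 h))).le
  exact ⟨w, f, h, fun y => (hf y).1, ⟨x, hf1 rfl⟩, hh⟩

end CoverFunctions

section CovarianceAlgebra

variable {X : Type u} [TopologicalSpace X] {n : ℕ} {σ : Fin n → C(X, X)}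

/-- The representation of the covariance algebra determined by a covariant pair. -/
def mkRep {A : Type*} [Ring A] [Algebra ℂ A] (φ : C(X, ℂ) →ₐ[ℂ] A) (s : Fin n → A)
    (h : IsCovariant σ φ s) : CovAlg σ →ₐ[ℂ] A :=
  RingQuot.liftAlgHom ℂ ⟨FreeAlgebra.lift ℂ (Sum.elim φ s), by
    intro x y hxy
    cases hxy with
    | scalar c => simp
    | add f g => simp
    | mul f g => simp
    | cov f i => simp [h f i]⟩

@[simp] theorem mkRep_coeff {A : Type*} [Ring A] [Algebra ℂ A] (φ : C(X, ℂ) →ₐ[ℂ] A)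
    (s : Fin n → A) (h : IsCovariant σ φ s) (f : C(X, ℂ)) : mkRep φ s h (coeff σ f) = φ f := by
  change RingQuot.liftAlgHom ℂ _ (RingQuot.mkAlgHom ℂ _ _) = _
  simp

@[simp] theorem mkRep_gen {A : Type*} [Ring A] [Algebra ℂ A] (φ : C(X, ℂ) →ₐ[ℂ] A)
    (s : Fin n → A) (h : IsCovariant σ φ s) (i : Fin n) : mkRep φ s h (gen σ i) = s i := by
  change RingQuot.liftAlgHom ℂ _ (RingQuot.mkAlgHom ℂ _ _) = _
  simp

/-- The polynomial `∑ s_w f_w` with coefficients `f_w`. -/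
def poly (σ : Fin n → C(X, X)) : (List (Fin n) →₀ C(X, ℂ)) →ₗ[ℂ] CovAlg σ :=
  Finsupp.lsum ℂ fun w => LinearMap.mulLeft ℂ (wordProd (gen σ) w) ∘ₗ (coeff σ).toLinearMap

theorem poly_single (w : List (Fin n)) (f : C(X, ℂ)) :
    poly σ (Finsupp.single w f) = wordProd (gen σ) w * coeff σ f := by
  simp [poly]

theorem mkRep_poly_single {A : Type*} [Ring A] [Algebra ℂ A] (φ : C(X, ℂ) →ₐ[ℂ] A)
    (s : Fin n → A) (h : IsCovariant σ φ s) (w : List (Fin n)) (f : C(X, ℂ)) :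
    mkRep φ s h (poly σ (Finsupp.single w f)) = wordProd s w * φ f := by
  rw [poly_single, map_mul, mkRep_coeff, map_wordProd]
  simp only [mkRep_gen]

theorem mul_poly_mem_range {x : CovAlg σ}
    (h : ∀ w f, x * poly σ (Finsupp.single w f) ∈ (poly σ).range) {a : CovAlg σ}
    (ha : a ∈ (poly σ).range) : x * a ∈ (poly σ).range := by
  obtain ⟨c, rfl⟩ := ha
  induction c using Finsupp.induction_linear with
  | zero => simp
  | add c d hc hd => simpa [mul_add] using add_mem hc hd
  | single w f => exact h w f

theorem poly_surjective : Function.Surjective (poly σ) := by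
  intro a
  obtain ⟨b, rfl⟩ := RingQuot.mkAlgHom_surjective ℂ (CovRel σ) a
  suffices h : ∀ a ∈ (poly σ).range, RingQuot.mkAlgHom ℂ (CovRel σ) b * a ∈ (poly σ).range by
    simpa using h 1 ⟨Finsupp.single [] 1, by simp [poly_single]⟩
  induction b using FreeAlgebra.induction with
  | grade0 r => exact fun a ha => by simpa [Algebra.smul_def] using Submodule.smul_mem _ r ha
  | grade1 x =>
    refine fun a => mul_poly_mem_range fun w f => ?_
    cases x with
    | inl g =>
      refine ⟨Finsupp.single w (g.comp (wordComp σ w) * f), ?_⟩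
      rw [poly_single, poly_single, map_mul, ← mul_assoc,
        ← IsCovariant.mul_wordProd (coeff_mul_gen σ), mul_assoc]
      rfl
    | inr i =>
      refine ⟨Finsupp.single (i :: w) f, ?_⟩
      rw [poly_single, poly_single, wordProd_cons, mul_assoc]
      rfl
  | mul a b ha hb => exact fun x hx => by simpa [mul_assoc] using ha _ (hb x hx)
  | add a b ha hb => exact fun x hx => by simpa [add_mul] using add_mem (ha x hx) (hb x hx)

open Classical in
/-- The `(u, v)` entry of the polynomial `∑ s_w f_w` in the Fock representation: the sum over the
words `w` with `u = wv` of the functions `f_w ∘ σ_v`. -/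
def fockEntry (σ : Fin n → C(X, X)) (u v : List (Fin n)) :
    (List (Fin n) →₀ C(X, ℂ)) →ₗ[ℂ] C(X, ℂ) :=
  Finsupp.lsum ℂ fun w => if u = w ++ v then
    (ContinuousMap.compStarAlgHom' ℂ ℂ (wordComp σ v)).toAlgHom.toLinearMap else 0

open Classical in
theorem fockEntry_single (u v w : List (Fin n)) (f : C(X, ℂ)) :
    fockEntry σ u v (Finsupp.single w f) = if u = w ++ v then f.comp (wordComp σ v) else 0 := by
  rw [fockEntry, Finsupp.lsum_single]
  split_ifs <;> rfl

end CovarianceAlgebra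

section CuntzFamilies

variable {A : Type*} [Ring A] [StarRing A] {n : ℕ} {t : Fin n → A}

/-- The Cuntz relations: the `tᵢ` are isometries whose range projections are orthogonal and sum
to `1`. -/
structure IsCuntzFamily (t : Fin n → A) : Prop where
  star_mul_eq : ∀ i k, star (t i) * t k = if i = k then 1 else 0
  sum_mul_star : ∑ i, t i * star (t i) = 1

namespace IsCuntzFamily

theorem map {B F : Type*} [Ring B] [StarRing B] [FunLike F A B] [RingHomClass F A B]
    [StarHomClass F A B] (h : IsCuntzFamily t) (ρ : F) : IsCuntzFamily fun i => ρ (t i) where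
  star_mul_eq i k := by
    rw [← map_star, ← map_mul, h.star_mul_eq, apply_ite ρ, map_one, map_zero]
  sum_mul_star := by simp only [← map_star, ← map_mul, ← map_sum, h.sum_mul_star, map_one]

theorem of_map {B F : Type*} [Ring B] [StarRing B] [FunLike F A B] [RingHomClass F A B]
    [StarHomClass F A B] {ρ : F} (hρ : Function.Injective ρ)
    (h : IsCuntzFamily fun i => ρ (t i)) : IsCuntzFamily t where
  star_mul_eq i k := hρ <| by
    rw [map_mul, map_star, h.star_mul_eq, apply_ite ρ, map_one, map_zero]
  sum_mul_star := hρ <| by simpa only [map_sum, map_mul, map_star, map_one] using h.sum_mul_star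

variable (h : IsCuntzFamily t)
include h

theorem star_cons_mul_cons (i k : Fin n) (v w : List (Fin n)) :
    star (wordProd t (i :: v)) * wordProd t (k :: w) =
      if i = k then star (wordProd t v) * wordProd t w else 0 := by
  rw [wordProd_cons, wordProd_cons, star_mul, mul_assoc, ← mul_assoc (star (t i)), h.star_mul_eq]
  split_ifs <;> simp

theorem star_wordProd_mul_append (v w : List (Fin n)) :
    star (wordProd t v) * wordProd t (v ++ w) = wordProd t w := by
  induction v with
  | nil => simp
  | cons i v ih => rw [List.cons_append, h.star_cons_mul_cons, if_pos rfl, ih]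

theorem star_append_mul_wordProd (v w : List (Fin n)) :
    star (wordProd t (v ++ w)) * wordProd t v = star (wordProd t w) := by
  rw [← star_star_mul, h.star_wordProd_mul_append]

theorem star_wordProd_mul_self (w : List (Fin n)) : star (wordProd t w) * wordProd t w = 1 := by
  simpa using h.star_wordProd_mul_append w []

theorem star_wordProd_mul_eq_zero {v w : List (Fin n)} (hvw : ¬ v <+: w) (hwv : ¬ w <+: v) :
    star (wordProd t v) * wordProd t w = 0 := by
  induction v generalizing w with
  | nil => simp at hvw
  | cons i v ih =>
    cases w with
    | nil => simp at hwv
    | cons k w =>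
      rw [h.star_cons_mul_cons]
      split_ifs with hik
      · subst hik
        rw [List.prefix_cons_inj] at hvw hwv
        exact ih hvw hwv
      · rfl

theorem star_wordProd_mul_of_length_eq {v w : List (Fin n)} (hl : v.length = w.length) :
    star (wordProd t v) * wordProd t w = if v = w then 1 else 0 := by
  split_ifs with hvw
  · rw [hvw, h.star_wordProd_mul_self]
  · exact h.star_wordProd_mul_eq_zero (fun hp => hvw (hp.eq_of_length hl))
      fun hp => hvw (hp.eq_of_length hl.symm).symm

theorem rowConj_one : rowConj t 1 = 1 := by
  simpa [rowConj_apply] using h.sum_mul_star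

theorem star_mul_rowConj_mul (i : Fin n) (b : A) : star (t i) * rowConj t b * t i = b :=
  calc star (t i) * rowConj t b * t i = ∑ k, star (t i) * t k * b * (star (t k) * t i) := by
        simp only [rowConj_apply, Finset.mul_sum, Finset.sum_mul, mul_assoc]
    _ = b := by simp [h.star_mul_eq]

theorem star_wordProd_mul_sum {k : ℕ} (u : words n k) (c : words n k → A) :
    star (wordProd t u) * ∑ v : words n k, wordProd t v * c v = c u := by
  have orthogonal (v : words n k) :
      star (wordProd t u) * (wordProd t v * c v) = if u = v then c v else 0 := by
    rw [← mul_assoc, h.star_wordProd_mul_of_length_eq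
      ((mem_words.mp u.2).trans (mem_words.mp v.2).symm), ite_mul, one_mul, zero_mul]
    simp only [Subtype.coe_inj]
  simp [Finset.mul_sum, orthogonal]

theorem sum_wordProd_mul_star (k : ℕ) :
    ∑ w ∈ words n k, wordProd t w * star (wordProd t w) = 1 := by
  simpa [rowConj_iterate] using Function.iterate_fixed h.rowConj_one k

end IsCuntzFamily

end CuntzFamilies

section BlockDiagonal

variable {E : Type*} [CStarAlgebra E] {n : ℕ} {t : Fin n → E}

/-- The homomorphism `(aᵢ) ↦ ∑ᵢ tᵢ aᵢ tᵢ^*` of block diagonal elements along a Cuntz family. -/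
def blockDiagonalHom (h : IsCuntzFamily t) : (Fin n → E) →⋆ₐ[ℂ] E where
  toFun a := ∑ i, t i * a i * star (t i)
  map_one' := by simpa using h.sum_mul_star
  map_mul' a b := by
    rw [Finset.sum_mul_sum]
    refine Finset.sum_congr rfl fun i _ => ?_
    have entry (k : Fin n) : t i * a i * star (t i) * (t k * b k * star (t k)) =
        if i = k then t i * (a i * b k) * star (t k) else 0 := by
      calc _ = t i * a i * (star (t i) * t k) * b k * star (t k) := by simp only [mul_assoc]
        _ = _ := by rw [h.star_mul_eq]; split_ifs <;> simp [mul_assoc]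
    simp [entry]
  map_zero' := by simp
  map_add' a b := by simp [mul_add, add_mul, Finset.sum_add_distrib]
  commutes' c := by
    simp [Algebra.algebraMap_eq_smul_one, ← Finset.smul_sum, h.sum_mul_star]
  map_star' a := by simp [mul_assoc]

namespace IsCuntzFamily

variable (h : IsCuntzFamily t)
include h

theorem norm_sum_mul_mul_star_le {a : Fin n → E} {C : ℝ} (hC : 0 ≤ C) (ha : ∀ i, ‖a i‖ ≤ C) :
    ‖∑ i, t i * a i * star (t i)‖ ≤ C :=
  (NonUnitalStarAlgHom.norm_apply_le (blockDiagonalHom h) a).trans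
    ((pi_norm_le_iff_of_nonneg hC).mpr ha)

theorem norm_le_one (i : Fin n) : ‖t i‖ ≤ 1 := by
  nontriviality E
  have h1 := CStarRing.norm_star_mul_self (x := t i)
  rw [h.star_mul_eq, if_pos rfl, CStarRing.norm_one] at h1
  nlinarith [norm_nonneg (t i)]

theorem norm_star_mul_mul_le (i : Fin n) (b : E) : ‖star (t i) * b * t i‖ ≤ ‖b‖ :=
  calc ‖star (t i) * b * t i‖ ≤ ‖star (t i)‖ * ‖b‖ * ‖t i‖ := norm_mul₃_le ..
    _ ≤ 1 * ‖b‖ * 1 := by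
      have := h.norm_le_one i
      gcongr
      rwa [norm_star]
    _ = ‖b‖ := by ring

theorem norm_rowConj (b : E) : ‖rowConj t b‖ = ‖b‖ := by
  refine le_antisymm (h.norm_sum_mul_mul_star_le (norm_nonneg _) fun _ => le_rfl) ?_
  cases n with
  | zero =>
    have : Subsingleton E := subsingleton_of_zero_eq_one (by simpa using h.sum_mul_star)
    rw [Subsingleton.elim b 0, norm_zero]
    exact norm_nonneg _
  | succ n =>
    simpa only [h.star_mul_rowConj_mul] using h.norm_star_mul_mul_le 0 (rowConj t b)

theorem norm_rowConj_iterate (k : ℕ) (b : E) : ‖(rowConj t)^[k] b‖ = ‖b‖ := by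
  induction k with
  | zero => rfl
  | succ k ih => rw [Function.iterate_succ_apply', h.norm_rowConj, ih]

end IsCuntzFamily

end BlockDiagonal

section CuntzPairs

variable {X : Type u} [TopologicalSpace X] {n : ℕ} {σ : Fin n → C(X, X)}
  {A : Type*} [Ring A] [StarRing A] [Algebra ℂ A] {t : Fin n → A} {π : C(Cover σ, ℂ) →⋆ₐ[ℂ] A}

/-- A covariant pair of a Cuntz family and a representation of the functions on the covering
space. -/
structure IsCuntzPair (t : Fin n → A) (π : C(Cover σ, ℂ) →⋆ₐ[ℂ] A) : Prop
    extends IsCuntzFamily t where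
  covariant : IsCovariant (coverMap σ) π t

namespace IsCuntzPair

theorem of_map {B : Type*} [Ring B] [StarRing B] [Algebra ℂ B] {ρ : A →⋆ₐ[ℂ] B}
    (hρ : Function.Injective ρ) (h : IsCuntzPair (fun i => ρ (t i)) (ρ.comp π)) :
    IsCuntzPair t π where
  toIsCuntzFamily := h.toIsCuntzFamily.of_map hρ
  covariant g i := hρ <| by simpa using h.covariant g i

theorem map {B : Type*} [Ring B] [StarRing B] [Algebra ℂ B] (h : IsCuntzPair t π)
    (ρ : A →⋆ₐ[ℂ] B) : IsCuntzPair (fun i => ρ (t i)) (ρ.comp π) where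
  toIsCuntzFamily := h.toIsCuntzFamily.map ρ
  covariant g i := by
    simpa only [map_mul, StarAlgHom.comp_apply] using congrArg ρ (h.covariant g i)

variable (h : IsCuntzPair t π)
include h

theorem map_eq_sum (g : C(Cover σ, ℂ)) :
    π g = ∑ i, t i * π (g.comp (coverMap σ i)) * star (t i) := by
  simp only [← h.covariant g _, mul_assoc, ← Finset.mul_sum, h.sum_mul_star, mul_one]

theorem map_comp_shift (g : C(Cover σ, ℂ)) : π (g.comp (shift σ)) = rowConj t (π g) :=
  h.map_eq_sum _

theorem map_indexIndicator (i : Fin n) : π (indexIndicator σ i) = t i * star (t i) := by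
  simp [h.map_eq_sum (indexIndicator σ i), indexIndicator_comp_coverMap, apply_ite π]

theorem star_mul_map_mul (g : C(Cover σ, ℂ)) (i k : Fin n) :
    star (t i) * π g * t k = if i = k then π (g.comp (coverMap σ i)) else 0 := by
  rw [mul_assoc, h.covariant, ← mul_assoc, h.star_mul_eq]
  split_ifs with hik
  · rw [one_mul, hik]
  · rw [zero_mul]

end IsCuntzPair

end CuntzPairs

section CuntzPairsCStar

open scoped CStarAlgebra

variable {X : Type u} [TopologicalSpace X] [CompactSpace X] [T2Space X] {n : ℕ}
  {σ : Fin n → C(X, X)} {E : Type*} [CStarAlgebra E] {t : Fin n → E}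
  {π : C(Cover σ, ℂ) →⋆ₐ[ℂ] E}

namespace IsCuntzPair

variable (h : IsCuntzPair t π)
include h

theorem map_mem {S : StarSubalgebra ℂ E} (hS : IsClosed (S : Set E)) (ht : ∀ i, t i ∈ S)
    (hproj : ∀ f : C(X, ℂ), π (f.comp (coverProj σ)) ∈ S) (g : C(Cover σ, ℂ)) : π g ∈ S := by
  have comap_eq_top : S.comap π = ⊤ := by
    refine starSubalgebra_cover_eq_top _ (hS.preimage (map_continuous π)) hproj
      (fun i => ?_) fun g hg => ?_
    · rw [StarSubalgebra.mem_comap, h.map_indexIndicator]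
      exact mul_mem (ht i) (star_mem (ht i))
    · rw [StarSubalgebra.mem_comap, h.map_comp_shift, rowConj_apply]
      exact sum_mem fun i _ => mul_mem (mul_mem (ht i) hg) (star_mem (ht i))
  rw [← StarSubalgebra.mem_comap, comap_eq_top]
  exact StarSubalgebra.mem_top

theorem unique {π' : C(Cover σ, ℂ) →⋆ₐ[ℂ] E} (h' : IsCuntzPair t π')
    (hproj : ∀ f : C(X, ℂ), π (f.comp (coverProj σ)) = π' (f.comp (coverProj σ))) : π = π' := by
  have equalizer_eq_top : StarAlgHom.equalizer π π' = ⊤ := by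
    refine starSubalgebra_cover_eq_top _ (isClosed_eq (map_continuous π) (map_continuous π'))
      hproj (fun i => ?_) fun g hg => ?_
    · exact (h.map_indexIndicator i).trans (h'.map_indexIndicator i).symm
    · exact (h.map_comp_shift g).trans
        ((congrArg (rowConj t) hg).trans (h'.map_comp_shift g).symm)
  ext g
  rw [← StarAlgHom.mem_equalizer, equalizer_eq_top]
  exact StarSubalgebra.mem_top

theorem injective (hproj : ∀ f : C(X, ℂ), π (f.comp (coverProj σ)) = 0 → f = 0) :
    Function.Injective π := by
  rw [injective_iff_map_eq_zero]
  intro g hg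
  by_contra hne
  obtain ⟨w, f, k, -, ⟨x, hx⟩, hk⟩ := exists_mul_comp_wordComp hne
  have map_comp_eq_zero : π (g.comp (wordComp (coverMap σ) w)) = 0 := by
    rw [← one_mul (π _), ← h.star_wordProd_mul_self w, mul_assoc, ← h.covariant.mul_wordProd, hg,
      zero_mul, mul_zero]
  let f' : C(X, ℂ) := .comp ⟨Complex.ofReal, Complex.continuous_ofReal⟩ f
  have hf' : f'.comp (coverProj σ) = k * g.comp (wordComp (coverMap σ) w) :=
    ContinuousMap.ext fun y => (hk y).symm
  have eq_zero : f' = 0 := hproj f' (by rw [hf', map_mul, map_comp_eq_zero, mul_zero])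
  simpa [f', hx] using DFunLike.congr_fun eq_zero x

end IsCuntzPair

end CuntzPairsCStar

section RowContractions

open scoped InnerProductSpace

variable {H : Type*} [NormedAddCommGroup H] [InnerProductSpace ℂ H] [CompleteSpace H] {n : ℕ}
  {T : Fin n → H →L[ℂ] H}

theorem inner_sum_apply (ξ : H) (h : Fin n → H) :
    ⟪ξ, ∑ i, T i (h i)⟫_ℂ = ∑ i, ⟪star (T i) ξ, h i⟫_ℂ := by
  simp only [inner_sum, star_inner_right]

theorem rowConj_one_le_one_iff :
    rowConj T 1 ≤ 1 ↔ ∀ h : Fin n → H, ‖∑ i, T i (h i)‖ ^ 2 ≤ ∑ i, ‖h i‖ ^ 2 := by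
  have hrow : rowConj T 1 = ∑ i, star (star (T i)) * star (T i) := by simp [rowConj_apply]
  rw [hrow, sum_star_mul_self_le_one_iff]
  constructor
  · intro hT h
    set η := ∑ i, T i (h i)
    have hη : ‖η‖ ^ 2 ≤ ∑ i, ‖star (T i) η‖ * ‖h i‖ := by
      calc ‖η‖ ^ 2 = ‖⟪η, η⟫_ℂ‖ := by simp [inner_self_eq_norm_sq_to_K]
        _ = ‖∑ i, ⟪star (T i) η, h i⟫_ℂ‖ := by rw [← inner_sum_apply]
        _ ≤ _ := (norm_sum_le _ _).trans (Finset.sum_le_sum fun i _ => norm_inner_le_norm _ _)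
    have hsq : (‖η‖ ^ 2) ^ 2 ≤ ‖η‖ ^ 2 * ∑ i, ‖h i‖ ^ 2 :=
      calc (‖η‖ ^ 2) ^ 2 ≤ (∑ i, ‖star (T i) η‖ * ‖h i‖) ^ 2 := by gcongr
        _ ≤ (∑ i, ‖star (T i) η‖ ^ 2) * ∑ i, ‖h i‖ ^ 2 := Finset.sum_mul_sq_le_sq_mul_sq ..
        _ ≤ _ := by gcongr; exact hT η
    have hnonneg : 0 ≤ ∑ i, ‖h i‖ ^ 2 := by positivity
    nlinarith [sq_nonneg ‖η‖]
  · intro hT ξ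
    have hsum : ∑ i, ‖star (T i) ξ‖ ^ 2 ≤ ‖ξ‖ * ‖∑ i, T i (star (T i) ξ)‖ := by
      calc ∑ i, ‖star (T i) ξ‖ ^ 2 = ‖∑ i, ⟪star (T i) ξ, star (T i) ξ⟫_ℂ‖ := by
            simp only [inner_self_eq_norm_sq_to_K]
            norm_cast
            exact (Real.norm_of_nonneg (by positivity)).symm
        _ = ‖⟪ξ, ∑ i, T i (star (T i) ξ)⟫_ℂ‖ := by rw [inner_sum_apply]
        _ ≤ _ := norm_inner_le_norm _ _
    nlinarith [hT fun i => star (T i) ξ, sq_nonneg (‖ξ‖ - ‖∑ i, T i (star (T i) ξ)‖)]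

end RowContractions

section SquareSummable

open scoped InnerProductSpace

variable {I : Type u}

/-- The Hilbert space of square summable functions on `I`. -/
abbrev L2 (I : Type u) : Type u := lp (fun _ : I => ℂ) 2

open Classical in
/-- The standard orthonormal basis vectors of `L2 I`. -/
def basisVec (y : I) : L2 I := lp.single 2 y 1

open Classical in
theorem basisVec_apply (y z : I) : basisVec y z = if z = y then 1 else 0 := by
  rw [basisVec, lp.single_apply, Pi.single_apply]

theorem inner_basisVec_left (y : I) (h : L2 I) : ⟪basisVec y, h⟫_ℂ = h y := by
  classical
  rw [basisVec, lp.inner_single_left]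
  simp

theorem orthonormal_basisVec : Orthonormal ℂ (basisVec : I → L2 I) := by
  classical
  rw [orthonormal_iff_ite]
  intro y z
  rw [inner_basisVec_left, basisVec_apply]

theorem clm_ext_basisVec {F : Type*} [NormedAddCommGroup F] [NormedSpace ℂ F]
    {S T : L2 I →L[ℂ] F} (h : ∀ y, S (basisVec y) = T (basisVec y)) : S = T := by
  classical
  refine lp.ext_continuousLinearMap (by simp) fun y => ?_
  ext
  simpa [basisVec] using h y

/-- The isometry of `L2 I` induced by an injective map of the basis. -/
def basisIsometry {θ : I → I} (hθ : Function.Injective θ) : L2 I →ₗᵢ[ℂ] L2 I :=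
  (orthonormal_basisVec.comp θ hθ).orthogonalFamily.linearIsometry

theorem basisIsometry_basisVec {θ : I → I} (hθ : Function.Injective θ) (y : I) :
    basisIsometry hθ (basisVec y) = basisVec (θ y) := by
  classical
  rw [basisIsometry, basisVec, OrthogonalFamily.linearIsometry_apply_single]
  simp

variable {Y : Type*} [TopologicalSpace Y] [CompactSpace Y]

theorem norm_apply_mul_le (g : C(Y, ℂ)) (y : Y) (c : ℂ) : ‖g y * c‖ ≤ ‖(‖g‖ : ℂ) * c‖ := by
  rw [norm_mul, norm_mul, Complex.norm_real, norm_norm]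
  gcongr
  exact g.norm_coe_le_norm y

theorem memℓp_apply_mul (r : I → Y) (g : C(Y, ℂ)) (h : L2 I) :
    Memℓp (fun y => g (r y) * h y) 2 :=
  ((lp.memℓp h).const_mul (‖g‖ : ℂ)).mono' fun _ => norm_apply_mul_le g _ _

/-- The operator on `L2 I` of multiplication by `g ∘ r`. -/
def mulOp (r : I → Y) (g : C(Y, ℂ)) : L2 I →L[ℂ] L2 I :=
  LinearMap.mkContinuous
    { toFun := fun h => ⟨fun y => g (r y) * h y, memℓp_apply_mul r g h⟩
      map_add' := fun h k => by ext y; exact mul_add _ _ _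
      map_smul' := fun c h => by ext y; exact mul_left_comm _ _ _ } ‖g‖ fun h => by
    refine (lp.norm_mono (y := (‖g‖ : ℂ) • h) two_ne_zero fun _ => norm_apply_mul_le g _ _).trans ?_
    rw [norm_smul, Complex.norm_real, norm_norm]

theorem mulOp_apply (r : I → Y) (g : C(Y, ℂ)) (h : L2 I) (y : I) :
    mulOp r g h y = g (r y) * h y := rfl

/-- The representation of `C(Y)` on `L2 I` by the multiplication operators `mulOp r`. -/
def mulHom (r : I → Y) : C(Y, ℂ) →⋆ₐ[ℂ] (L2 I →L[ℂ] L2 I) where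
  toFun := mulOp r
  map_one' := by ext h y; exact one_mul _
  map_mul' f g := by ext h y; exact mul_assoc _ _ _
  map_zero' := by ext h y; exact zero_mul _
  map_add' f g := by ext h y; exact add_mul _ _ _
  commutes' c := by ext h y; rfl
  map_star' g := by
    rw [ContinuousLinearMap.star_eq_adjoint, ContinuousLinearMap.eq_adjoint_iff]
    intro h k
    rw [lp.inner_eq_tsum, lp.inner_eq_tsum]
    refine tsum_congr fun y => ?_
    simp only [mulOp_apply, RCLike.inner_apply, ContinuousMap.star_apply, map_mul,
      RCLike.star_def, RingHomCompTriple.comp_apply, RingHom.id_apply]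
    ring

theorem mulHom_basisVec (r : I → Y) (g : C(Y, ℂ)) (y : I) :
    mulHom r g (basisVec y) = g (r y) • basisVec y := by
  classical
  ext z
  change g (r z) * basisVec y z = g (r y) * basisVec y z
  rw [basisVec_apply]
  split_ifs with h
  · rw [h]
  · simp

end SquareSummable

section OrbitRepresentation

open scoped InnerProductSpace

variable {X : Type u} [TopologicalSpace X] {n : ℕ} (σ : Fin n → C(X, X))

/-- The index set of the orbit representation. The second coordinate counts applications of the
maps, so that words of different lengths never send a point to the same index. -/
abbrev OrbitIndex : Type u := Cover σ × ℤ

/-- The map `(z, m) ↦ (σ̃ᵢ z, m + 1)`. -/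
def orbitStep (i : Fin n) (y : OrbitIndex σ) : OrbitIndex σ := (coverMap σ i y.1, y.2 + 1)

variable {σ}

theorem orbitStep_inj {i k : Fin n} {y z : OrbitIndex σ} :
    orbitStep σ i y = orbitStep σ k z ↔ i = k ∧ y = z := by
  refine ⟨fun h => ⟨congrArg (fun q : OrbitIndex σ => firstIndex q.1) h, Prod.ext ?_ ?_⟩, ?_⟩
  · exact congrArg (fun q : OrbitIndex σ => shift σ q.1) h
  · simpa [orbitStep] using congrArg Prod.snd h
  · rintro ⟨rfl, rfl⟩
    rfl

theorem orbitStep_injective (i : Fin n) : Function.Injective (orbitStep σ i) :=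
  fun _ _ h => (orbitStep_inj.mp h).2

variable (σ)

/-- The isometries of the orbit representation. -/
def orbitGen (i : Fin n) : L2 (OrbitIndex σ) →L[ℂ] L2 (OrbitIndex σ) :=
  (basisIsometry (orbitStep_injective i)).toContinuousLinearMap

theorem orbitGen_basisVec (i : Fin n) (y : OrbitIndex σ) :
    orbitGen σ i (basisVec y) = basisVec (orbitStep σ i y) :=
  basisIsometry_basisVec (orbitStep_injective i) y

theorem star_orbitGen_mul (i k : Fin n) :
    star (orbitGen σ i) * orbitGen σ k = if i = k then 1 else 0 := by
  classical
  refine clm_ext_basisVec fun y => ?_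
  ext z
  rw [← inner_basisVec_left, mul_apply_eq_comp, star_inner_right, star_star, orbitGen_basisVec,
    orbitGen_basisVec, inner_basisVec_left, basisVec_apply]
  simp only [orbitStep_inj]
  by_cases h : i = k <;> simp [h, basisVec_apply]

theorem isCuntzFamily_orbitGen : IsCuntzFamily (orbitGen σ) where
  star_mul_eq := star_orbitGen_mul σ
  sum_mul_star := by
    refine clm_ext_basisVec fun y => ?_
    have hy : basisVec y = orbitGen σ (firstIndex y.1) (basisVec (shift σ y.1, y.2 - 1)) := by
      rw [orbitGen_basisVec, orbitStep, coverMap_firstIndex, sub_add_cancel]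
    rw [hy, ← mul_apply_eq_comp, Finset.sum_mul]
    simp [mul_assoc, star_orbitGen_mul]

theorem wordProd_orbitGen_basisVec (w : List (Fin n)) (y : OrbitIndex σ) :
    wordProd (orbitGen σ) w (basisVec y) =
      basisVec (wordComp (coverMap σ) w y.1, y.2 + w.length) := by
  induction w with
  | nil => simp [wordComp]
  | cons i w ih =>
    rw [wordProd_cons, mul_apply_eq_comp, ih, orbitGen_basisVec, orbitStep]
    simp [add_assoc, wordComp]

variable [CompactSpace X] [T2Space X]

/-- Multiplication by functions on the covering space, in the orbit representation. -/
def orbitMul : C(Cover σ, ℂ) →⋆ₐ[ℂ] (L2 (OrbitIndex σ) →L[ℂ] L2 (OrbitIndex σ)) :=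
  mulHom Prod.fst

theorem orbitMul_basisVec (g : C(Cover σ, ℂ)) (y : OrbitIndex σ) :
    orbitMul σ g (basisVec y) = g y.1 • basisVec y :=
  mulHom_basisVec Prod.fst g y

theorem isCuntzPair_orbit : IsCuntzPair (orbitGen σ) (orbitMul σ) where
  toIsCuntzFamily := isCuntzFamily_orbitGen σ
  covariant g i := by
    refine clm_ext_basisVec fun y => ?_
    rw [mul_apply_eq_comp, mul_apply_eq_comp, orbitGen_basisVec, orbitMul_basisVec,
      orbitMul_basisVec, map_smul, orbitGen_basisVec]
    rfl

/-- The orbit representation of the covariance algebra. -/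
def orbitRep : CovAlg σ →ₐ[ℂ] (L2 (OrbitIndex σ) →L[ℂ] L2 (OrbitIndex σ)) :=
  mkRep ((orbitMul σ).comp (ContinuousMap.compStarAlgHom' ℂ ℂ (coverProj σ))).toAlgHom (orbitGen σ)
    fun f i => (isCuntzPair_orbit σ).covariant (f.comp (coverProj σ)) i

@[simp] theorem orbitRep_coeff (f : C(X, ℂ)) :
    orbitRep σ (coeff σ f) = orbitMul σ (f.comp (coverProj σ)) := mkRep_coeff _ _ _ f

@[simp] theorem orbitRep_gen (i : Fin n) : orbitRep σ (gen σ i) = orbitGen σ i :=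
  mkRep_gen _ _ _ i

theorem orbitRep_poly_single (w : List (Fin n)) (f : C(X, ℂ)) :
    orbitRep σ (poly σ (Finsupp.single w f)) =
      wordProd (orbitGen σ) w * orbitMul σ (f.comp (coverProj σ)) :=
  mkRep_poly_single _ _ _ w f

theorem isRowContractive_orbitRep : IsRowContractive σ (orbitRep σ) := by
  refine ⟨fun f => ?_, ?_⟩
  · rw [orbitRep_coeff, orbitRep_coeff, ← map_star]
    rfl
  · simpa only [orbitRep_gen] using
      rowConj_one_le_one_iff.mp (isCuntzFamily_orbitGen σ).rowConj_one.le

end OrbitRepresentation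

section PoissonTransform

open Filter Topology

variable {X : Type u} [TopologicalSpace X] {n : ℕ} {σ : Fin n → C(X, X)}
  {H : Type*} [NormedAddCommGroup H] [InnerProductSpace ℂ H] [CompleteSpace H]
  {T : Fin n → H →L[ℂ] H} {φ : C(X, ℂ) →⋆ₐ[ℂ] (H →L[ℂ] H)}

theorem rowConj_iterate_one_nonneg (T : Fin n → H →L[ℂ] H) (k : ℕ) : 0 ≤ (rowConj T)^[k] 1 := by
  rw [rowConj_iterate]
  exact Finset.sum_nonneg fun w _ => star_right_conjugate_nonneg zero_le_one _

theorem rowConj_iterate_one_le {s : ℝ} (hs : 0 ≤ s) (hT : rowConj T 1 ≤ s • 1) (k : ℕ) :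
    (rowConj T)^[k] 1 ≤ s ^ k • 1 := by
  induction k with
  | zero => simp
  | succ k ih =>
    calc (rowConj T)^[k + 1] 1 = rowConj T ((rowConj T)^[k] 1) :=
          Function.iterate_succ_apply' _ _ _
      _ ≤ rowConj T (s ^ k • 1) :=
          Finset.sum_le_sum fun i _ => star_right_conjugate_le_conjugate ih _
      _ = s ^ k • rowConj T 1 := by simp [rowConj_apply, Finset.smul_sum]
      _ ≤ s ^ k • s • 1 := smul_le_smul_of_nonneg_left hT (pow_nonneg hs k)
      _ = s ^ (k + 1) • 1 := by rw [pow_succ, mul_smul]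

theorem tendsto_rowConj_iterate_one {s : ℝ} (hs : 0 ≤ s) (hs1 : s < 1)
    (hT : rowConj T 1 ≤ s • 1) : Tendsto (fun k => (rowConj T)^[k] 1) atTop (𝓝 0) := by
  refine squeeze_zero_norm (fun k => ?_) (tendsto_pow_atTop_nhds_zero_of_lt_one hs hs1)
  rw [CStarAlgebra.norm_le_iff_le_algebraMap _ (pow_nonneg hs k) (rowConj_iterate_one_nonneg T k),
    Algebra.algebraMap_eq_smul_one]
  exact rowConj_iterate_one_le hs hT k

/-- The defect operator `(1 - ∑ Tᵢ Tᵢ^*) ^ (1 / 2)` of a row contraction. -/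
def defect (T : Fin n → H →L[ℂ] H) : H →L[ℂ] H := CFC.sqrt (1 - rowConj T 1)

theorem star_defect (T : Fin n → H →L[ℂ] H) : star (defect T) = defect T :=
  (CFC.sqrt_nonneg _).isSelfAdjoint

theorem defect_mul_defect (hT : rowConj T 1 ≤ 1) : defect T * defect T = 1 - rowConj T 1 :=
  CFC.sqrt_mul_sqrt_self _ (sub_nonneg.mpr hT)

theorem commute_defect (hφ : IsCovariant σ φ T) (f : C(X, ℂ)) : Commute (defect T) (φ f) := by
  rw [defect, CFC.sqrt_eq_cfc]
  exact ((Commute.one_left _).sub_left (hφ.commute_rowConj_one f)).cfc_nnreal _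

/-- The component at the word `w` of the Poisson transform of a row contraction, the map from `H`
to the `H`-valued square summable functions on the words. -/
def poisson (T : Fin n → H →L[ℂ] H) (w : List (Fin n)) : H →L[ℂ] H :=
  defect T * star (wordProd T w)

theorem star_poisson (T : Fin n → H →L[ℂ] H) (w : List (Fin n)) :
    star (poisson T w) = wordProd T w * defect T := by
  rw [poisson, star_mul, star_star, star_defect]

theorem sum_star_poisson_mul (hT : rowConj T 1 ≤ 1) (M : ℕ) :
    ∑ w ∈ wordsBelow n M, star (poisson T w) * poisson T w = 1 - (rowConj T)^[M] 1 := by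
  have sum_words_eq : ∀ k, ∑ w ∈ words n k, star (poisson T w) * poisson T w =
      (rowConj T)^[k] 1 - (rowConj T)^[k + 1] 1 := fun k => by
    rw [Function.iterate_succ_apply, ← iterate_map_sub, ← defect_mul_defect hT, rowConj_iterate]
    refine Finset.sum_congr rfl fun w _ => ?_
    rw [star_poisson, poisson]
    simp only [mul_assoc]
  simp only [sum_wordsBelow, sum_words_eq]
  exact Finset.sum_range_sub' _ _

theorem sum_star_poisson_mul_le_one (hT : rowConj T 1 ≤ 1) (M : ℕ) :
    ∑ w : wordsBelow n M, star (poisson T w) * poisson T w ≤ 1 := by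
  rw [Finset.sum_coe_sort (wordsBelow n M) fun w => star (poisson T w) * poisson T w,
    sum_star_poisson_mul hT]
  exact sub_le_self _ (rowConj_iterate_one_nonneg T M)

theorem star_poisson_mul_poisson (hφ : IsCovariant σ φ T) (w v : List (Fin n)) (f : C(X, ℂ)) :
    star (poisson T (w ++ v)) * φ (f.comp (wordComp σ v)) * poisson T v =
      wordProd T w * φ f * (star (poisson T v) * poisson T v) :=
  calc star (poisson T (w ++ v)) * φ (f.comp (wordComp σ v)) * poisson T v
      = wordProd T w * wordProd T v * (defect T * φ (f.comp (wordComp σ v))) * poisson T v := by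
        rw [star_poisson, wordProd_append]
        simp only [mul_assoc]
    _ = wordProd T w * (wordProd T v * φ (f.comp (wordComp σ v))) * defect T * poisson T v := by
        rw [(commute_defect hφ _).eq]
        simp only [mul_assoc]
    _ = wordProd T w * φ f * (star (poisson T v) * poisson T v) := by
        rw [← hφ.mul_wordProd, star_poisson]
        simp only [mul_assoc]

theorem sum_poisson_fockEntry_single (hT : rowConj T 1 ≤ 1) (hφ : IsCovariant σ φ T) (M : ℕ)
    (w : List (Fin n)) (f : C(X, ℂ)) :
    ∑ u ∈ wordsBelow n M, ∑ v ∈ wordsBelow n M,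
      star (poisson T u) * φ (fockEntry σ u v (Finsupp.single w f)) * poisson T v =
    wordProd T w * φ f * (1 - (rowConj T)^[M - w.length] 1) := by
  classical
  have sum_eq : ∀ v, ∑ u ∈ wordsBelow n M,
      star (poisson T u) * φ (fockEntry σ u v (Finsupp.single w f)) * poisson T v =
      if w ++ v ∈ wordsBelow n M then
        wordProd T w * φ f * (star (poisson T v) * poisson T v) else 0 := fun v => by
    rw [← star_poisson_mul_poisson hφ, ← Finset.sum_ite_eq' (wordsBelow n M) (w ++ v)
      fun u => star (poisson T u) * φ (f.comp (wordComp σ v)) * poisson T v]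
    refine Finset.sum_congr rfl fun u _ => ?_
    rw [fockEntry_single]
    split_ifs <;> simp
  have filter_eq : (wordsBelow n M).filter (fun v => w ++ v ∈ wordsBelow n M) =
      wordsBelow n (M - w.length) := by
    ext v
    simp only [Finset.mem_filter, mem_wordsBelow, List.length_append]
    omega
  rw [Finset.sum_comm, ← sum_star_poisson_mul hT, Finset.mul_sum, ← filter_eq, Finset.sum_filter]
  exact Finset.sum_congr rfl fun v _ => sum_eq v

theorem tendsto_sum_poisson_fockEntry {s : ℝ} (hs : 0 ≤ s) (hs1 : s < 1)
    (hT : rowConj T 1 ≤ s • 1) (hT1 : rowConj T 1 ≤ 1) (hφ : IsCovariant σ φ T)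
    (c : List (Fin n) →₀ C(X, ℂ)) :
    Tendsto (fun M => ∑ u ∈ wordsBelow n M, ∑ v ∈ wordsBelow n M,
      star (poisson T u) * φ (fockEntry σ u v c) * poisson T v) atTop
      (𝓝 (mkRep φ.toAlgHom T hφ (poly σ c))) := by
  induction c using Finsupp.induction_linear with
  | zero => simp
  | add c d hc hd =>
    rw [map_add, map_add]
    refine (hc.add hd).congr fun M => ?_
    simp only [map_add, mul_add, add_mul, Finset.sum_add_distrib]
  | single w f =>
    have tail := (tendsto_rowConj_iterate_one hs hs1 hT).comp (tendsto_sub_atTop_nat w.length)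
    have lim := (tail.const_sub 1).const_mul (wordProd T w * φ f)
    rw [sub_zero, mul_one] at lim
    rw [mkRep_poly_single]
    exact lim.congr fun M => (sum_poisson_fockEntry_single hT1 hφ M w f).symm

end PoissonTransform

section Domination

open scoped InnerProductSpace
open Filter Topology

variable {X : Type u} [TopologicalSpace X] {n : ℕ} {σ : Fin n → C(X, X)}

/-- The basis vector of the orbit representation at the point `σ̃_v z`. -/
def orbitVec (z : Cover σ) (v : List (Fin n)) : L2 (OrbitIndex σ) :=
  basisVec (wordComp (coverMap σ) v z, (v.length : ℤ))

theorem orthonormal_orbitVec (z : Cover σ) : Orthonormal ℂ (orbitVec z) := by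
  refine orthonormal_basisVec.comp (fun v : List (Fin n) =>
    ((wordComp (coverMap σ) v z, (v.length : ℤ)) : OrbitIndex σ)) fun u v h => ?_
  obtain ⟨hpoint, hlength⟩ := Prod.ext_iff.mp h
  exact (wordComp_coverMap_inj (Int.ofNat_inj.mp hlength) hpoint).1

theorem wordProd_orbitGen_orbitVec (z : Cover σ) (w v : List (Fin n)) :
    wordProd (orbitGen σ) w (orbitVec z v) = orbitVec z (w ++ v) := by
  rw [orbitVec, wordProd_orbitGen_basisVec, orbitVec, wordComp_append, List.length_append,
    Nat.cast_add, add_comm]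
  rfl

variable [CompactSpace X] [T2Space X]

theorem orbitMul_orbitVec (z : Cover σ) (v : List (Fin n)) (f : C(X, ℂ)) :
    orbitMul σ (f.comp (coverProj σ)) (orbitVec z v) =
      f (wordComp σ v (coverProj σ z)) • orbitVec z v := by
  rw [orbitVec, orbitMul_basisVec, ← coverProj_wordComp]
  rfl

theorem inner_orbitRep_poly (z : Cover σ) (c : List (Fin n) →₀ C(X, ℂ)) (u v : List (Fin n)) :
    ⟪orbitVec z u, orbitRep σ (poly σ c) (orbitVec z v)⟫_ℂ =
      fockEntry σ u v c (coverProj σ z) := by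
  classical
  induction c using Finsupp.induction_linear with
  | zero => simp
  | add c d hc hd =>
    rw [map_add, map_add, add_apply, inner_add_right, hc, hd, map_add]
    rfl
  | single w f =>
    rw [orbitRep_poly_single, mul_apply_eq_comp, orbitMul_orbitVec, map_smul,
      wordProd_orbitGen_orbitVec, inner_smul_right, fockEntry_single,
      orthonormal_iff_ite.mp (orthonormal_orbitVec z)]
    split_ifs <;> simp

theorem norm_map_fockMatrix_le (hσ : IsSurjective σ) {B : Type*} [CStarAlgebra B] {m : ℕ}
    (c : Fin m → Fin m → List (Fin n) →₀ C(X, ℂ)) (M : ℕ)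
    (ψ : CStarMatrix (wordsBelow n M × Fin m) (wordsBelow n M × Fin m) C(X, ℂ) →⋆ₙₐ[ℂ] B) :
    ‖ψ (CStarMatrix.ofMatrix fun i k => fockEntry σ i.1 k.1 (c i.2 k.2))‖ ≤
      ‖CStarMatrix.ofMatrix (Matrix.of fun k l => orbitRep σ (poly σ (c k l)))‖ := by
  refine norm_map_le_of_evalMatrix_le ψ _ (norm_nonneg _) fun x => ?_
  obtain ⟨z, rfl⟩ := coverProj_surjective hσ x
  rw [evalMatrix_apply]
  refine le_of_eq_of_le ?_ (norm_scalarCompression_le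
    ((orthonormal_orbitVec z).comp (Subtype.val : wordsBelow n M → _) Subtype.val_injective) _)
  congr 3
  ext i k
  exact (inner_orbitRep_poly z (c i.2 k.2) i.1 k.1).symm

variable {H : Type u} [NormedAddCommGroup H] [InnerProductSpace ℂ H] [CompleteSpace H]

theorem norm_mkRep_le_orbitRep (hσ : IsSurjective σ) {φ : C(X, ℂ) →⋆ₐ[ℂ] (H →L[ℂ] H)}
    {T : Fin n → H →L[ℂ] H} {s : ℝ} (hs : 0 ≤ s) (hs1 : s < 1) (hT : rowConj T 1 ≤ s • 1)
    (hT1 : rowConj T 1 ≤ 1) (hφ : IsCovariant σ φ T) {m : ℕ}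
    (a : Matrix (Fin m) (Fin m) (CovAlg σ)) :
    ‖CStarMatrix.ofMatrix (a.map (mkRep φ.toAlgHom T hφ))‖ ≤
      ‖CStarMatrix.ofMatrix (a.map (orbitRep σ))‖ := by
  choose c hc using fun k l => poly_surjective (σ := σ) (a k l)
  obtain rfl : a = Matrix.of fun k l => poly σ (c k l) := Matrix.ext fun k l => (hc k l).symm
  let compressed : ℕ → Matrix (Fin m) (Fin m) (H →L[ℂ] H) := fun M => Matrix.of fun k l =>
    ∑ u ∈ wordsBelow n M, ∑ v ∈ wordsBelow n M,
      star (poisson T u) * φ (fockEntry σ u v (c k l)) * poisson T v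
  have lim : Tendsto (fun M => CStarMatrix.ofMatrix (compressed M)) atTop (𝓝 _) :=
    tendsto_ofMatrix fun k l => tendsto_sum_poisson_fockEntry hs hs1 hT hT1 hφ (c k l)
  refine le_of_tendsto lim.norm (Eventually.of_forall fun M => ?_)
  have fock_le := norm_map_fockMatrix_le hσ c M (CStarMatrix.mapₙₐ (n := wordsBelow n M × Fin m)
    (φ : C(X, ℂ) →⋆ₙₐ[ℂ] (H →L[ℂ] H)))
  refine le_of_eq_of_le ?_ ((norm_compression_le (sum_star_poisson_mul_le_one hT1 M) _).trans
    fock_le)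
  refine congrArg (fun A => ‖CStarMatrix.ofMatrix A‖) (Matrix.ext fun k l => ?_)
  change ∑ u ∈ wordsBelow n M, ∑ v ∈ wordsBelow n M,
    star (poisson T u) * φ (fockEntry σ u v (c k l)) * poisson T v = _
  simp only [← Finset.sum_coe_sort (wordsBelow n M)]
  rfl

theorem norm_map_le_orbitRep (hσ : IsSurjective σ) {ρ : CovAlg σ →ₐ[ℂ] (H →L[ℂ] H)}
    (hρ : IsRowContractive σ ρ) {m : ℕ} (a : Matrix (Fin m) (Fin m) (CovAlg σ)) :
    ‖CStarMatrix.ofMatrix (a.map ρ)‖ ≤ ‖CStarMatrix.ofMatrix (a.map (orbitRep σ))‖ := by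
  let φ : C(X, ℂ) →⋆ₐ[ℂ] (H →L[ℂ] H) := { ρ.comp (coeff σ) with map_star' := hρ.1 }
  let S : Fin n → H →L[ℂ] H := fun i => ρ (gen σ i)
  have covariant : ∀ r : ℝ, IsCovariant σ φ (r • S) := fun r f i => by
    change ρ (coeff σ f) * (r • ρ (gen σ i)) = r • ρ (gen σ i) * ρ (coeff σ (f.comp (σ i)))
    rw [mul_smul_comm, smul_mul_assoc, ← map_mul, coeff_mul_gen, map_mul]
  let dilation : ℝ → CovAlg σ →ₐ[ℂ] (H →L[ℂ] H) := fun r =>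
    mkRep φ.toAlgHom (r • S) (covariant r)
  have dilation_le : ∀ r ∈ Set.Ioo (0 : ℝ) 1, ‖CStarMatrix.ofMatrix (a.map (dilation r))‖ ≤
      ‖CStarMatrix.ofMatrix (a.map (orbitRep σ))‖ := fun r hr => by
    have hr2 : r ^ 2 < 1 := by nlinarith [hr.1, hr.2]
    have hS : rowConj (r • S) 1 ≤ r ^ 2 • 1 :=
      calc rowConj (r • S) 1 = r ^ 2 • rowConj S 1 := by
            simp [rowConj_apply, Finset.smul_sum, smul_smul, sq]
        _ ≤ r ^ 2 • 1 := smul_le_smul_of_nonneg_left (rowConj_one_le_one_iff.mpr hρ.2) (sq_nonneg r)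
    have hS1 : rowConj (r • S) 1 ≤ 1 :=
      calc rowConj (r • S) 1 ≤ r ^ 2 • 1 := hS
        _ ≤ (1 : ℝ) • 1 := smul_le_smul_of_nonneg_right hr2.le zero_le_one
        _ = 1 := one_smul ℝ 1
    exact norm_mkRep_le_orbitRep hσ (sq_nonneg r) hr2 hS hS1 (covariant r) a
  have lim : ∀ b, Tendsto (fun r => dilation r b) (𝓝[<] 1) (𝓝 (ρ b)) := fun b => by
    obtain ⟨c, rfl⟩ := poly_surjective b
    induction c using Finsupp.induction_linear with
    | zero => simp
    | add c d hc hd => simpa only [map_add] using hc.add hd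
    | single w f =>
      have dilation_eq : ∀ r, dilation r (poly σ (Finsupp.single w f)) =
          r ^ w.length • ρ (poly σ (Finsupp.single w f)) := fun r => by
        rw [mkRep_poly_single, wordProd_smul, smul_mul_assoc, poly_single, map_mul, map_wordProd]
        rfl
      have cont : Continuous fun r => dilation r (poly σ (Finsupp.single w f)) := by
        simp only [dilation_eq]
        fun_prop
      simpa [dilation_eq] using (cont.tendsto 1).mono_left nhdsWithin_le_nhds
  exact le_of_tendsto (tendsto_ofMatrix fun k l => lim (a k l)).norm
    (mem_of_superset (Ioo_mem_nhdsLT zero_lt_one) dilation_le)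

end Domination

section OrbitAlgebra

variable {X : Type u} [TopologicalSpace X] [CompactSpace X] [T2Space X] {n : ℕ}
  (σ : Fin n → C(X, X))

/-- The C*-algebra generated by the orbit representation. -/
def orbitAlg : StarSubalgebra ℂ (L2 (OrbitIndex σ) →L[ℂ] L2 (OrbitIndex σ)) :=
  (StarAlgebra.adjoin ℂ (Set.range (orbitRep σ))).topologicalClosure

instance isClosed_orbitAlg :
    IsClosed (orbitAlg σ : Set (L2 (OrbitIndex σ) →L[ℂ] L2 (OrbitIndex σ))) :=
  StarSubalgebra.isClosed_topologicalClosure _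

theorem orbitRep_mem_orbitAlg (a : CovAlg σ) : orbitRep σ a ∈ orbitAlg σ :=
  StarSubalgebra.le_topologicalClosure _ (StarAlgebra.subset_adjoin ℂ _ ⟨a, rfl⟩)

/-- The orbit representation as a homomorphism into the C*-algebra that it generates. -/
def orbitHom : CovAlg σ →ₐ[ℂ] orbitAlg σ :=
  (orbitRep σ).codRestrict (orbitAlg σ).toSubalgebra (orbitRep_mem_orbitAlg σ)

instance : PartialOrder (orbitAlg σ) := CStarAlgebra.spectralOrder _

instance : StarOrderedRing (orbitAlg σ) := CStarAlgebra.spectralOrderedRing _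

theorem orbitMul_mem_orbitAlg (g : C(Cover σ, ℂ)) : orbitMul σ g ∈ orbitAlg σ := by
  refine (isCuntzPair_orbit σ).map_mem (isClosed_orbitAlg σ) (fun i => ?_) (fun f => ?_) g
  · rw [← orbitRep_gen]
    exact orbitRep_mem_orbitAlg σ _
  · rw [← orbitRep_coeff]
    exact orbitRep_mem_orbitAlg σ _

/-- The multiplication operators inside the C*-algebra of the orbit representation. -/
def orbitMulHom : C(Cover σ, ℂ) →⋆ₐ[ℂ] orbitAlg σ :=
  (orbitMul σ).codRestrict (orbitAlg σ) (orbitMul_mem_orbitAlg σ)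

theorem orbitMulHom_comp_coverProj (f : C(X, ℂ)) :
    orbitMulHom σ (f.comp (coverProj σ)) = orbitHom σ (coeff σ f) :=
  Subtype.ext (orbitRep_coeff σ f).symm

theorem isCuntzPair_orbitHom : IsCuntzPair (fun i => orbitHom σ (gen σ i)) (orbitMulHom σ) := by
  have pair := isCuntzPair_orbit σ
  rw [← funext (orbitRep_gen σ)] at pair
  exact .of_map (ρ := (orbitAlg σ).subtype) Subtype.val_injective pair

theorem orbitMul_injective : Function.Injective (orbitMul σ) := by
  rw [injective_iff_map_eq_zero]
  intro g hg
  ext z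
  have basisVec_eq_zero := orbitMul_basisVec σ g (z, 0)
  rw [hg, zero_apply, eq_comm, smul_eq_zero_iff_left (orthonormal_basisVec.ne_zero _)]
    at basisVec_eq_zero
  exact basisVec_eq_zero

variable {σ}

theorem norm_map_orbitHom {m : ℕ} (a : Matrix (Fin m) (Fin m) (CovAlg σ)) :
    ‖CStarMatrix.ofMatrix (a.map (orbitHom σ))‖ = ‖CStarMatrix.ofMatrix (a.map (orbitRep σ))‖ := by
  have injective : Function.Injective (CStarMatrix.mapₙₐ (n := Fin m)
      ((orbitAlg σ).subtype : orbitAlg σ →⋆ₙₐ[ℂ] (L2 (OrbitIndex σ) →L[ℂ] L2 (OrbitIndex σ)))) := by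
    intro M N h
    ext i k : 2
    exact congrFun (congrFun h i) k
  rw [← NonUnitalStarAlgHom.norm_map _ injective]
  rfl

theorem isCStarCover_orbitHom (hσ : IsSurjective σ) : IsCStarCover σ (orbitHom σ) where
  isometric m a := by
    rw [norm_map_orbitHom]
    symm
    refine IsGreatest.csSup_eq ⟨⟨_, _, _, _, orbitRep σ, isRowContractive_orbitRep σ, rfl⟩, ?_⟩
    rintro r ⟨H, _, _, _, ρ, hρ, rfl⟩
    exact norm_map_le_orbitRep hσ hρ a
  generates := by
    have map_adjoin : (StarAlgebra.adjoin ℂ (Set.range (orbitHom σ))).map (orbitAlg σ).subtype =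
        StarAlgebra.adjoin ℂ (Set.range (orbitRep σ)) := by
      rw [StarAlgHom.map_adjoin, ← Set.range_comp]
      rfl
    rw [eq_top_iff]
    rintro d -
    change d ∈ closure (StarAlgebra.adjoin ℂ (Set.range (orbitHom σ)) : Set (orbitAlg σ))
    rw [closure_subtype]
    have hd : (d : L2 (OrbitIndex σ) →L[ℂ] L2 (OrbitIndex σ)) ∈
        closure (StarAlgebra.adjoin ℂ (Set.range (orbitRep σ)) : Set _) := d.2
    rwa [← map_adjoin] at hd

end OrbitAlgebra

section Envelope

variable {X : Type u} [TopologicalSpace X] [CompactSpace X] [T2Space X] {n : ℕ}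
  {σ : Fin n → C(X, X)} {E : Type u} [CStarAlgebra E] [PartialOrder E] [StarOrderedRing E]
  {j : CovAlg σ →ₐ[ℂ] E}

theorem IsCStarEnvelope.exists_isCuntzPair (hσ : IsSurjective σ) (hj : IsCStarEnvelope σ j) :
    ∃ π : C(Cover σ, ℂ) →⋆ₐ[ℂ] E,
      IsCuntzPair (fun i => j (gen σ i)) π ∧ IsCoverExtension σ j π := by
  obtain ⟨q, -, hq⟩ := hj.minimal (orbitAlg σ) (orbitHom σ) (isCStarCover_orbitHom hσ)
  have pair := (isCuntzPair_orbitHom σ).map q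
  simp only [hq] at pair
  refine ⟨q.comp (orbitMulHom σ), pair, fun f => ?_, pair.covariant⟩
  rw [StarAlgHom.comp_apply, orbitMulHom_comp_coverProj, hq]

theorem IsCStarEnvelope.eq_zero_of_map_coeff_eq_zero (hσ : IsSurjective σ)
    (hj : IsCStarEnvelope σ j) {f : C(X, ℂ)} (hf : j (coeff σ f) = 0) : f = 0 := by
  let a : Matrix (Fin 1) (Fin 1) (CovAlg σ) := Matrix.of fun _ _ => coeff σ f
  have map_eq_zero : CStarMatrix.ofMatrix (a.map j) = 0 := by
    ext
    exact hf
  have map_orbitHom_eq_zero : CStarMatrix.ofMatrix (a.map (orbitHom σ)) = 0 := by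
    rw [← norm_eq_zero, (isCStarCover_orbitHom hσ).isometric, ← hj.isometric, map_eq_zero,
      norm_zero]
  have comp_eq_zero : f.comp (coverProj σ) = 0 := by
    refine (map_eq_zero_iff (orbitMul σ) (orbitMul_injective σ)).mp ?_
    rw [← orbitRep_coeff]
    exact congrArg Subtype.val (congrFun (congrFun map_orbitHom_eq_zero 0) 0)
  ext x
  obtain ⟨z, rfl⟩ := coverProj_surjective hσ x
  exact DFunLike.congr_fun comp_eq_zero z

end Envelope

section CoreAlgebra

open Filter Topology

variable {X : Type u} [TopologicalSpace X] {n : ℕ} {σ : Fin n → C(X, X)}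
  {E : Type u} [CStarAlgebra E]

/-- The elements `t_u g t_v^*` with `|u| = |v|` and `g ∈ I`. -/
def coreGen (t : Fin n → E) (π : C(Cover σ, ℂ) →⋆ₐ[ℂ] E) (I : Ideal C(Cover σ, ℂ)) : Set E :=
  {b | ∃ u v : List (Fin n), ∃ g ∈ I, u.length = v.length ∧
    b = wordProd t u * π g * star (wordProd t v)}

/-- The closed linear span of the elements `t_u g t_v^*` with `|u| = |v|` and `g ∈ I`. For `I = ⊤`
it is the algebra `𝔅`; for a smaller ideal it is a candidate for an ideal of `𝔅`. -/
def coreOf (t : Fin n → E) (π : C(Cover σ, ℂ) →⋆ₐ[ℂ] E) (I : Ideal C(Cover σ, ℂ)) :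
    Submodule ℂ E :=
  (Submodule.span ℂ (coreGen t π I)).topologicalClosure

variable {t : Fin n → E} {π : C(Cover σ, ℂ) →⋆ₐ[ℂ] E} {I : Ideal C(Cover σ, ℂ)}

theorem core_eq_coreOf_top (j : CovAlg σ →ₐ[ℂ] E) (π : C(Cover σ, ℂ) →⋆ₐ[ℂ] E) :
    core σ j π = coreOf (fun i => j (gen σ i)) π ⊤ := by
  simp [core, coreOf, coreGen, wordElt, wordProd]

theorem mem_coreOf {u v : List (Fin n)} (hl : u.length = v.length) {g : C(Cover σ, ℂ)}
    (hg : g ∈ I) : wordProd t u * π g * star (wordProd t v) ∈ coreOf t π I :=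
  Submodule.le_topologicalClosure _ (Submodule.subset_span ⟨u, v, g, hg, hl, rfl⟩)

theorem map_mem_coreOf {g : C(Cover σ, ℂ)} (hg : g ∈ I) : π g ∈ coreOf t π I := by
  simpa using mem_coreOf (t := t) (π := π) (u := []) (v := []) rfl hg

theorem wordProd_mul_star_mem_coreOf {u v : List (Fin n)} (hl : u.length = v.length) :
    wordProd t u * star (wordProd t v) ∈ coreOf t π ⊤ := by
  simpa using mem_coreOf (t := t) (π := π) hl (Submodule.mem_top (x := 1))

theorem isClosed_coreOf : IsClosed (coreOf t π I : Set E) :=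
  Submodule.isClosed_topologicalClosure _

theorem coreOf_mono {I' : Ideal C(Cover σ, ℂ)} (hI : I ≤ I') : coreOf t π I ≤ coreOf t π I' :=
  Submodule.topologicalClosure_mono <| Submodule.span_mono fun _ ⟨u, v, g, hg, hb⟩ =>
    ⟨u, v, g, hI hg, hb⟩

theorem coreOf_le_comap {F : Type*} [AddCommGroup F] [Module ℂ F] [TopologicalSpace F]
    {J : Submodule ℂ F} (hJ : IsClosed (J : Set F)) {L : E →ₗ[ℂ] F} (hL : Continuous L)
    (h : ∀ u v : List (Fin n), ∀ g ∈ I, u.length = v.length →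
      L (wordProd t u * π g * star (wordProd t v)) ∈ J) : coreOf t π I ≤ J.comap L := by
  refine Submodule.topologicalClosure_minimal _ (Submodule.span_le.mpr ?_) (hJ.preimage hL)
  rintro _ ⟨u, v, g, hg, hl, rfl⟩
  exact h u v g hg hl

/-- The diagonal part `∑ p_w b p_w` of `b`, where `p_w = t_w t_w^*` and `|w| = l`. As `l` grows,
the diagonal parts of the elements of `𝔅` converge to functions. -/
def diagPart (t : Fin n → E) (l : ℕ) : E →ₗ[ℂ] E :=
  ∑ w ∈ words n l, LinearMap.mulLeft ℂ (wordProd t w * star (wordProd t w)) ∘ₗ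
    LinearMap.mulRight ℂ (wordProd t w * star (wordProd t w))

theorem diagPart_apply (l : ℕ) (b : E) :
    diagPart t l b = ∑ w ∈ words n l, wordProd t w * star (wordProd t w) * b *
      (wordProd t w * star (wordProd t w)) := by
  simp [diagPart, mul_assoc]

theorem diagPart_zero (b : E) : diagPart t 0 b = b := by
  simp [diagPart_apply, sum_words_zero]

theorem diagPart_succ (l : ℕ) (b : E) :
    diagPart t (l + 1) b = ∑ i, t i * diagPart t l (star (t i) * b * t i) * star (t i) := by
  simp only [diagPart_apply, sum_words_succ, wordProd_cons, star_mul, Finset.mul_sum,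
    Finset.sum_mul, mul_assoc]

/-- The function to which the diagonal parts of `t_u g t_v^*`, `|u| = |v|`, stabilize. The value
on words of different lengths is irrelevant. -/
def diagFun : List (Fin n) → List (Fin n) → C(Cover σ, ℂ) → C(Cover σ, ℂ)
  | [], [], g => g
  | i :: u, k :: v, g =>
    if i = k then (diagFun u v g).comp (shift σ) * indexIndicator σ i else 0
  | _, _, _ => 0

theorem diagFun_mem (hI : ∀ g ∈ I, g.comp (shift σ) ∈ I) {g : C(Cover σ, ℂ)} (hg : g ∈ I)
    (u v : List (Fin n)) : diagFun u v g ∈ I := by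
  induction u generalizing v with
  | nil =>
    cases v with
    | nil => exact hg
    | cons => exact I.zero_mem
  | cons i u ih =>
    cases v with
    | nil => exact I.zero_mem
    | cons k v =>
      rw [diagFun]
      split_ifs
      · exact I.mul_mem_right _ (hI _ (ih v))
      · exact I.zero_mem

theorem exists_mem_tendsto_of_forall_eventually_dist_lt {α ι : Type*} [PseudoMetricSpace α]
    [CompleteSpace α] {l : Filter ι} [l.NeBot] {f : ι → α} {S : Set α} (hS : IsClosed S)
    (h : ∀ ε > 0, ∃ y ∈ S, ∀ᶠ i in l, dist (f i) y < ε) : ∃ y ∈ S, Tendsto f l (𝓝 y) := by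
  have cauchy : Cauchy (l.map f) := Metric.cauchy_iff.mpr ⟨inferInstance, fun ε hε => by
    obtain ⟨y, -, hy⟩ := h (ε / 2) (half_pos hε)
    refine ⟨Metric.ball y (ε / 2), hy, fun a ha b hb => ?_⟩
    exact (dist_triangle_right a b y).trans_lt ((add_lt_add ha hb).trans_eq (add_halves ε))⟩
  obtain ⟨x, hx⟩ := CompleteSpace.complete cauchy
  refine ⟨x, hS.closure_eq ▸ Metric.mem_closure_iff.mpr fun ε hε => ?_, hx⟩
  obtain ⟨y, hyS, hy⟩ := h (ε / 2) (half_pos hε)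
  have lim : Tendsto (fun i => dist (f i) y) l (𝓝 (dist x y)) := Tendsto.dist hx tendsto_const_nhds
  exact ⟨y, hyS, (le_of_tendsto lim (hy.mono fun _ => le_of_lt)).trans_lt (half_lt_self hε)⟩

namespace IsCuntzPair

variable (h : IsCuntzPair t π)

include h

theorem norm_diagPart_le (l : ℕ) (b : E) : ‖diagPart t l b‖ ≤ ‖b‖ := by
  induction l generalizing b with
  | zero => rw [diagPart_zero]
  | succ l ih =>
    rw [diagPart_succ]
    exact h.norm_sum_mul_mul_star_le (norm_nonneg _) fun i =>
      (ih _).trans (h.norm_star_mul_mul_le i b)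

theorem diagPart_map (l : ℕ) (g : C(Cover σ, ℂ)) : diagPart t l (π g) = π g := by
  induction l generalizing g with
  | zero => exact diagPart_zero _
  | succ l ih => simp only [diagPart_succ, h.star_mul_map_mul, if_true, ih, ← h.map_eq_sum]

theorem map_diagFun_cons (i k : Fin n) (u v : List (Fin n)) (g : C(Cover σ, ℂ)) :
    π (diagFun (i :: u) (k :: v) g) =
      if i = k then t i * π (diagFun u v g) * star (t i) else 0 := by
  rw [diagFun, apply_ite π, map_zero, map_mul, h.map_comp_shift, h.map_indexIndicator,
    rowConj_apply, ← mul_assoc, Finset.sum_mul]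
  simp [mul_assoc, h.star_mul_eq]

theorem diagPart_wordProd_mul (u v : List (Fin n)) (hl : u.length = v.length)
    (g : C(Cover σ, ℂ)) {l : ℕ} (hul : u.length ≤ l) :
    diagPart t l (wordProd t u * π g * star (wordProd t v)) = π (diagFun u v g) := by
  induction l generalizing u v with
  | zero =>
    obtain rfl := List.length_eq_zero_iff.mp (Nat.le_zero.mp hul)
    obtain rfl := List.length_eq_zero_iff.mp hl.symm
    simp [diagPart_zero, diagFun]
  | succ l ih =>
    match u, v, hl with
    | [], [], _ => simp [diagFun, h.diagPart_map]
    | i :: u, k :: v, hl =>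
      have corner (m : Fin n) :
          star (t m) * (wordProd t (i :: u) * π g * star (wordProd t (k :: v))) * t m =
            if m = i ∧ k = m then wordProd t u * π g * star (wordProd t v) else 0 :=
        calc _ = star (t m) * t i * (wordProd t u * π g * star (wordProd t v)) *
              (star (t k) * t m) := by simp only [wordProd_cons, star_mul, mul_assoc]
          _ = _ := by
            rw [h.star_mul_eq, h.star_mul_eq]
            by_cases hmi : m = i <;> by_cases hkm : k = m <;> simp [hmi, hkm]
      rw [diagPart_succ, h.map_diagFun_cons, Finset.sum_eq_single i]
      · simp only [corner, true_and, eq_comm (a := k)]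
        rw [apply_ite (diagPart t l), ih u v (by simpa using hl) (by simpa using hul)]
        split_ifs <;> simp
      · intro m _ hm
        rw [corner, if_neg fun hmk => hm hmk.1, map_zero, mul_zero, zero_mul]
      · simp

theorem exists_diagPart_eq (hI : ∀ g ∈ I, g.comp (shift σ) ∈ I) {b : E}
    (hb : b ∈ Submodule.span ℂ (coreGen t π I)) :
    ∃ g ∈ I, ∃ L, ∀ l ≥ L, diagPart t l b = π g := by
  induction hb using Submodule.span_induction with
  | mem b hb =>
    obtain ⟨u, v, g, hg, hl, rfl⟩ := hb
    exact ⟨diagFun u v g, diagFun_mem hI hg u v, u.length, fun l hul =>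
      h.diagPart_wordProd_mul u v hl g hul⟩
  | zero => exact ⟨0, I.zero_mem, 0, fun l _ => by simp⟩
  | add a b _ _ ha hb =>
    obtain ⟨g, hg, L, hL⟩ := ha
    obtain ⟨g', hg', L', hL'⟩ := hb
    exact ⟨g + g', I.add_mem hg hg', max L L', fun l hl => by
      rw [map_add, map_add, hL l (le_of_max_le_left hl), hL' l (le_of_max_le_right hl)]⟩
  | smul c a _ ha =>
    obtain ⟨g, hg, L, hL⟩ := ha
    exact ⟨c • g, I.smul_of_tower_mem c hg, L, fun l hl => by rw [map_smul, map_smul, hL l hl]⟩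

theorem exists_norm_diagPart_sub_lt (hI : ∀ g ∈ I, g.comp (shift σ) ∈ I) {b : E}
    (hb : b ∈ coreOf t π I) {ε : ℝ} (hε : 0 < ε) :
    ∃ g ∈ I, ∃ L, ∀ l ≥ L, ‖diagPart t l b - π g‖ < ε := by
  obtain ⟨y, hy, hby⟩ := Metric.mem_closure_iff.mp hb ε hε
  obtain ⟨g, hg, L, hL⟩ := h.exists_diagPart_eq hI hy
  refine ⟨g, hg, L, fun l hl => ?_⟩
  rw [← hL l hl, ← map_sub]
  exact (h.norm_diagPart_le l _).trans_lt (by rwa [← dist_eq_norm])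

theorem exists_tendsto_diagPart [CompactSpace X] [T2Space X] (hπ : Function.Injective π)
    {b : E} (hb : b ∈ coreOf t π ⊤) : ∃ g, Tendsto (fun l => diagPart t l b) atTop (𝓝 (π g)) := by
  have range_closed : IsClosed (Set.range π) :=
    (NonUnitalStarAlgHom.isometry π hπ).isClosedEmbedding.isClosed_range
  obtain ⟨_, ⟨g, rfl⟩, lim⟩ :=
    exists_mem_tendsto_of_forall_eventually_dist_lt range_closed fun ε hε => by
      obtain ⟨g, -, L, hL⟩ := h.exists_norm_diagPart_sub_lt (fun _ _ => Submodule.mem_top) hb hε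
      exact ⟨π g, ⟨g, rfl⟩, eventually_atTop.mpr ⟨L, fun l hl => by
        simpa [dist_eq_norm] using hL l hl⟩⟩
  exact ⟨g, lim⟩

end IsCuntzPair

end CoreAlgebra

section CoreIdeals

open Filter Topology
open scoped InnerProductSpace

variable {X : Type u} [TopologicalSpace X] {n : ℕ} {σ : Fin n → C(X, X)}
  {E : Type u} [CStarAlgebra E] {t : Fin n → E} {π : C(Cover σ, ℂ) →⋆ₐ[ℂ] E}
  {J : Submodule ℂ E}

/-- The linear span of the elements `t_u g t_v^*` with `|u| = |v| = k`. -/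
def levelSpan (t : Fin n → E) (π : C(Cover σ, ℂ) →⋆ₐ[ℂ] E) (k : ℕ) : Submodule ℂ E :=
  Submodule.span ℂ {b | ∃ u v : List (Fin n), ∃ g, u.length = k ∧ v.length = k ∧
    b = wordProd t u * π g * star (wordProd t v)}

theorem span_coreGen_le_iSup : Submodule.span ℂ (coreGen t π ⊤) ≤ ⨆ k, levelSpan t π k := by
  refine Submodule.span_le.mpr ?_
  rintro _ ⟨u, v, g, -, hl, rfl⟩
  exact Submodule.mem_iSup_of_mem u.length (Submodule.subset_span ⟨u, v, g, rfl, hl.symm, rfl⟩)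

/-- The operator `∑ ξ_u t_u` over the words `u` of length `k`. -/
def vecOp (t : Fin n → E) {k : ℕ} (ξ : EuclideanSpace ℂ (words n k)) : E :=
  ∑ u : words n k, ξ u • wordProd t u

theorem wordProd_mul_star_vecOp_mem {k : ℕ} {w : List (Fin n)} (hw : w.length = k)
    (ξ : EuclideanSpace ℂ (words n k)) :
    wordProd t w * star (vecOp t ξ) ∈ coreOf t π ⊤ := by
  rw [vecOp, star_sum, Finset.mul_sum]
  refine Submodule.sum_mem _ fun u _ => ?_
  rw [star_smul, mul_smul_comm]
  exact Submodule.smul_mem _ _ (wordProd_mul_star_mem_coreOf (hw.trans (mem_words.mp u.2).symm))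

theorem vecOp_mul_star_wordProd_mem {k : ℕ} {w : List (Fin n)} (hw : w.length = k)
    (ξ : EuclideanSpace ℂ (words n k)) :
    vecOp t ξ * star (wordProd t w) ∈ coreOf t π ⊤ := by
  rw [vecOp, Finset.sum_mul]
  refine Submodule.sum_mem _ fun u _ => ?_
  rw [smul_mul_assoc]
  exact Submodule.smul_mem _ _ (wordProd_mul_star_mem_coreOf ((mem_words.mp u.2).trans hw.symm))

namespace IsCuntzFamily

variable (h : IsCuntzFamily t)

include h

theorem star_wordProd_mul_vecOp {k : ℕ} (u : words n k) (ξ : EuclideanSpace ℂ (words n k)) :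
    star (wordProd t u) * vecOp t ξ = ξ u • 1 := by
  simpa only [vecOp, mul_smul_comm, mul_one] using h.star_wordProd_mul_sum u fun v => ξ v • 1

theorem star_vecOp_mul_wordProd {k : ℕ} (u : words n k) (ξ : EuclideanSpace ℂ (words n k)) :
    star (vecOp t ξ) * wordProd t u = star (ξ u) • 1 := by
  rw [← star_star_mul, h.star_wordProd_mul_vecOp, star_smul, star_one]

theorem star_vecOp_mul_self {k : ℕ} (ξ : EuclideanSpace ℂ (words n k)) :
    star (vecOp t ξ) * vecOp t ξ = ((‖ξ‖ ^ 2 : ℝ) : ℂ) • 1 := by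
  conv_lhs => rw [vecOp, Finset.mul_sum]
  rw [EuclideanSpace.norm_sq_eq, Complex.ofReal_sum, Finset.sum_smul]
  refine Finset.sum_congr rfl fun u _ => ?_
  rw [mul_smul_comm, ← vecOp, h.star_vecOp_mul_wordProd, smul_smul, Complex.ofReal_pow,
    ← Complex.mul_conj']
  rfl

theorem norm_vecOp_le {k : ℕ} (ξ : EuclideanSpace ℂ (words n k)) : ‖vecOp t ξ‖ ≤ ‖ξ‖ := by
  refine le_of_sq_le_sq ?_ (norm_nonneg _)
  calc ‖vecOp t ξ‖ ^ 2 = ‖((‖ξ‖ ^ 2 : ℝ) : ℂ) • (1 : E)‖ := by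
        rw [← h.star_vecOp_mul_self, CStarRing.norm_star_mul_self, sq]
    _ ≤ ‖ξ‖ ^ 2 * 1 := by
        rw [norm_smul, Complex.norm_real, norm_pow, norm_norm]
        nontriviality E
        rw [CStarRing.norm_one]
    _ = ‖ξ‖ ^ 2 := mul_one _

end IsCuntzFamily

namespace IsIdealOf

theorem sandwich_mem {B : Submodule ℂ E} (hJ : IsIdealOf B J) {a b c : E} (ha : a ∈ B)
    (hb : b ∈ J) (hc : c ∈ B) : a * b * c ∈ J :=
  hJ.mul_right c hc _ (hJ.mul_left a ha b hb)

variable (hJ : IsIdealOf (coreOf t π ⊤) J)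

include hJ

theorem diagPart_mem {b : E} (hb : b ∈ J) (l : ℕ) : diagPart t l b ∈ J := by
  rw [diagPart_apply]
  exact Submodule.sum_mem _ fun w _ => hJ.sandwich_mem (wordProd_mul_star_mem_coreOf rfl) hb
    (wordProd_mul_star_mem_coreOf rfl)

theorem rowConj_iterate_compression_mem {b : E} (hb : b ∈ J) {k : ℕ}
    (ξ η : EuclideanSpace ℂ (words n k)) :
    (rowConj t)^[k] (star (vecOp t ξ) * b * vecOp t η) ∈ J := by
  rw [rowConj_iterate]
  refine Submodule.sum_mem _ fun w hw => ?_
  have hw := mem_words.mp hw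
  simpa only [mul_assoc] using hJ.sandwich_mem (wordProd_mul_star_vecOp_mem hw ξ) hb
    (vecOp_mul_star_wordProd_mem hw η)

end IsIdealOf

namespace IsCuntzPair

variable (h : IsCuntzPair t π)

/-- The `*`-homomorphism `A ↦ ∑ t_u A_{uv} t_v^*` from the matrices over `C(X̃)` indexed by the
words of length `k`. -/
def levelHom (k : ℕ) : CStarMatrix (words n k) (words n k) C(Cover σ, ℂ) →⋆ₙₐ[ℂ] E where
  toFun A := ∑ u : words n k, ∑ v : words n k, wordProd t u * π (A u v) * star (wordProd t v)
  map_smul' c A := by simp [Finset.smul_sum]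
  map_zero' := by simp
  map_add' A B := by simp [mul_add, add_mul, Finset.sum_add_distrib]
  map_mul' A B := by
    have entry (v : words n k) : star (wordProd t v) *
        ∑ y : words n k, ∑ x : words n k, wordProd t y * (π (B y x) * star (wordProd t x)) =
          ∑ x : words n k, π (B v x) * star (wordProd t x) := by
      simp only [← Finset.mul_sum]
      exact h.star_wordProd_mul_sum v _
    simp only [Finset.sum_mul, mul_assoc, entry]
    simp only [CStarMatrix.mul_apply, map_sum, map_mul, Finset.mul_sum, Finset.sum_mul, mul_assoc]
    exact Finset.sum_congr rfl fun u _ => Finset.sum_comm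
  map_star' A := by
    rw [star_sum, Finset.sum_comm]
    simp [star_sum, mul_assoc, CStarMatrix.star_apply, map_star]

theorem levelHom_apply (k : ℕ) (A : CStarMatrix (words n k) (words n k) C(Cover σ, ℂ)) :
    h.levelHom k A =
      ∑ u : words n k, ∑ v : words n k, wordProd t u * π (A u v) * star (wordProd t v) := rfl

theorem levelHom_single {k : ℕ} (u v : words n k) (g : C(Cover σ, ℂ)) :
    h.levelHom k (CStarMatrix.ofMatrix (Matrix.single u v g)) =
      wordProd t u * π g * star (wordProd t v) := by
  rw [levelHom_apply, Finset.sum_eq_single u, Finset.sum_eq_single v]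
  · simp
  · intro y _ hy
    simp [Matrix.single_apply_of_col_ne _ _ hy.symm]
  · simp
  · intro y _ hy
    simp [Matrix.single_apply_of_row_ne hy.symm]
  · simp

include h in
theorem levelSpan_mono : Monotone (levelSpan t π) := by
  refine monotone_nat_of_le_succ fun k => Submodule.span_le.mpr ?_
  rintro _ ⟨u, v, g, hu, hv, rfl⟩
  rw [h.map_eq_sum g, Finset.mul_sum, Finset.sum_mul]
  refine Submodule.sum_mem _ fun i _ => Submodule.subset_span
    ⟨u ++ [i], v ++ [i], g.comp (coverMap σ i), by simp [hu], by simp [hv], ?_⟩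
  simp [wordProd_append, mul_assoc]

theorem exists_levelHom_eq {b : E} (hb : b ∈ Submodule.span ℂ (coreGen t π ⊤)) :
    ∃ k A, h.levelHom k A = b := by
  obtain ⟨k, hk⟩ := (Submodule.mem_iSup_of_directed _ h.levelSpan_mono.directed_le).mp
    (span_coreGen_le_iSup hb)
  have levelSpan_le : levelSpan t π k ≤ LinearMap.range (h.levelHom k :
      CStarMatrix (words n k) (words n k) C(Cover σ, ℂ) →ₗ[ℂ] E) := by
    refine Submodule.span_le.mpr ?_
    rintro _ ⟨u, v, g, hu, hv, rfl⟩
    exact ⟨_, h.levelHom_single ⟨u, mem_words.mpr hu⟩ ⟨v, mem_words.mpr hv⟩ g⟩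
  exact ⟨k, levelSpan_le hk⟩

theorem star_vecOp_mul_levelHom_mul {k : ℕ} (ξ η : EuclideanSpace ℂ (words n k))
    (A : CStarMatrix (words n k) (words n k) C(Cover σ, ℂ)) :
    star (vecOp t ξ) * h.levelHom k A * vecOp t η =
      π (∑ u, ∑ v, (star (ξ u) * η v) • A u v) := by
  simp only [levelHom_apply, Finset.mul_sum, Finset.sum_mul, map_sum, map_smul]
  refine Finset.sum_congr rfl fun u _ => Finset.sum_congr rfl fun v _ => ?_
  calc _ = star (vecOp t ξ) * wordProd t u * π (A u v) * (star (wordProd t v) * vecOp t η) := by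
        simp only [mul_assoc]
    _ = _ := by
      rw [h.star_vecOp_mul_wordProd, h.star_wordProd_mul_vecOp, smul_mul_assoc, one_mul,
        mul_smul_comm, mul_one, smul_smul, mul_comm]

include h in
theorem exists_map_eq_rowConj_iterate (k : ℕ) (g : C(Cover σ, ℂ)) :
    ∃ f, π f = (rowConj t)^[k] (π g) := by
  induction k with
  | zero => exact ⟨g, rfl⟩
  | succ k ih =>
    obtain ⟨f, hf⟩ := ih
    exact ⟨f.comp (shift σ), by rw [h.map_comp_shift, hf, Function.iterate_succ_apply']⟩

variable [CompactSpace X] [T2Space X]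

include h in
theorem tendsto_diagPart_zero (hπ : Function.Injective π) (hJ : IsIdealOf (coreOf t π ⊤) J)
    (hJπ : ∀ g, π g ∈ J → g = 0) {b : E} (hb : b ∈ J) :
    Tendsto (fun l => diagPart t l b) atTop (𝓝 0) := by
  obtain ⟨g, lim⟩ := h.exists_tendsto_diagPart hπ (hJ.le hb)
  have hg : π g ∈ J := hJ.closed.mem_of_tendsto lim (Eventually.of_forall (hJ.diagPart_mem hb))
  rwa [hJπ g hg, map_zero] at lim

include h in
theorem norm_map_le_norm_map_sub (hπ : Function.Injective π) (hJ : IsIdealOf (coreOf t π ⊤) J)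
    (hJπ : ∀ g, π g ∈ J → g = 0) {b : E} (hb : b ∈ J) (g : C(Cover σ, ℂ)) :
    ‖π g‖ ≤ ‖π g - b‖ := by
  have lim : Tendsto (fun l => ‖π g - diagPart t l b‖) atTop (𝓝 ‖π g‖) := by
    simpa using (tendsto_const_nhds.sub (h.tendsto_diagPart_zero hπ hJ hJπ hb)).norm
  refine le_of_tendsto lim (Eventually.of_forall fun l => ?_)
  calc ‖π g - diagPart t l b‖ = ‖diagPart t l (π g - b)‖ := by rw [map_sub, h.diagPart_map]
    _ ≤ ‖π g - b‖ := h.norm_diagPart_le l _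

theorem norm_levelHom_le_norm_sub (hπ : Function.Injective π) (hJ : IsIdealOf (coreOf t π ⊤) J)
    (hJπ : ∀ g, π g ∈ J → g = 0) {b : E} (hb : b ∈ J) {k : ℕ}
    (A : CStarMatrix (words n k) (words n k) C(Cover σ, ℂ)) :
    ‖h.levelHom k A‖ ≤ ‖h.levelHom k A - b‖ := by
  refine norm_map_le_of_evalMatrix_le _ A (norm_nonneg _) fun z =>
    norm_le_of_norm_inner_le (norm_nonneg _) fun ξ η => ?_
  set g : C(Cover σ, ℂ) := ∑ u, ∑ v, (star (ξ u) * η v) • A u v with hg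
  have inner_eq : ⟪ξ, evalMatrix z A η⟫_ℂ = g z := by
    simp only [evalMatrix_apply, PiLp.inner_apply, Matrix.ofLp_toEuclideanCLM, Matrix.mulVec,
      dotProduct, Finset.mul_sum, hg, RCLike.inner_apply', ContinuousMap.sum_apply,
      ContinuousMap.smul_apply, smul_eq_mul, Matrix.of_apply, starRingEnd_apply]
    exact Finset.sum_congr rfl fun u _ => Finset.sum_congr rfl fun v _ => by ring
  obtain ⟨f, hf⟩ := h.exists_map_eq_rowConj_iterate k g
  calc ‖⟪ξ, evalMatrix z A η⟫_ℂ‖ ≤ ‖g‖ := inner_eq ▸ g.norm_coe_le_norm z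
    _ = ‖π f‖ := by rw [hf, h.norm_rowConj_iterate, NonUnitalStarAlgHom.norm_map π hπ]
    _ ≤ ‖π f - (rowConj t)^[k] (star (vecOp t ξ) * b * vecOp t η)‖ :=
      h.norm_map_le_norm_map_sub hπ hJ hJπ (hJ.rowConj_iterate_compression_mem hb ξ η) f
    _ = ‖star (vecOp t ξ) * (h.levelHom k A - b) * vecOp t η‖ := by
      rw [hf, ← iterate_map_sub, h.norm_rowConj_iterate, ← h.star_vecOp_mul_levelHom_mul, mul_sub,
        sub_mul]
    _ ≤ ‖star (vecOp t ξ)‖ * ‖h.levelHom k A - b‖ * ‖vecOp t η‖ := norm_mul₃_le ..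
    _ ≤ ‖ξ‖ * ‖h.levelHom k A - b‖ * ‖η‖ := by
      rw [norm_star]
      gcongr <;> exact h.norm_vecOp_le _
    _ = ‖h.levelHom k A - b‖ * (‖ξ‖ * ‖η‖) := by ring

include h in
theorem eq_bot_of_map_mem_imp_eq_zero (hπ : Function.Injective π)
    (hJ : IsIdealOf (coreOf t π ⊤) J) (hJπ : ∀ g, π g ∈ J → g = 0) : J = ⊥ := by
  rw [Submodule.eq_bot_iff]
  intro b hb
  have isClosed : IsClosed {y : E | ‖y‖ ≤ ‖y - b‖} :=
    isClosed_le continuous_norm (continuous_id.sub continuous_const).norm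
  have norm_le : ‖b‖ ≤ ‖b - b‖ := closure_minimal (fun y hy => by
    obtain ⟨k, A, rfl⟩ := h.exists_levelHom_eq hy
    exact h.norm_levelHom_le_norm_sub hπ hJ hJπ hb A) isClosed (hJ.le hb)
  simpa using norm_le

end IsCuntzPair

end CoreIdeals

section InvariantIdeals

variable {X : Type u} [TopologicalSpace X] {n : ℕ} {σ : Fin n → C(X, X)}
  {E : Type u} [CStarAlgebra E] {t : Fin n → E} {π : C(Cover σ, ℂ) →⋆ₐ[ℂ] E}
  {J : Submodule ℂ E}

/-- The normalized sum `n^{-1/2} (t₁ + ⋯ + tₙ)`. -/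
def avg (t : Fin n → E) : E := (((Real.sqrt n)⁻¹ : ℝ) : ℂ) • ∑ i, t i

theorem star_avg (t : Fin n → E) :
    star (avg t) = (((Real.sqrt n)⁻¹ : ℝ) : ℂ) • ∑ i, star (t i) := by
  rw [avg, star_smul, star_sum, Complex.star_def, Complex.conj_ofReal]

namespace IsCuntzFamily

variable (h : IsCuntzFamily t)
include h

theorem star_mul_avg (i : Fin n) : star (t i) * avg t = (((Real.sqrt n)⁻¹ : ℝ) : ℂ) • 1 := by
  simp [avg, Finset.mul_sum, h.star_mul_eq]

theorem star_avg_mul (i : Fin n) : star (avg t) * t i = (((Real.sqrt n)⁻¹ : ℝ) : ℂ) • 1 := by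
  simp [star_avg, Finset.sum_mul, h.star_mul_eq]

theorem star_avg_mul_avg (hn : n ≠ 0) : star (avg t) * avg t = 1 := by
  have sq_sqrt : ((Real.sqrt n : ℝ) : ℂ) * (Real.sqrt n : ℝ) = n := by
    exact_mod_cast Real.mul_self_sqrt (Nat.cast_nonneg (α := ℝ) n)
  have hne : (n : ℂ) ≠ 0 := Nat.cast_ne_zero.mpr hn
  rw [star_avg, smul_mul_assoc, Finset.sum_mul]
  simp only [h.star_mul_avg, Finset.sum_const, Finset.card_univ, Fintype.card_fin, smul_smul,
    ← Nat.cast_smul_eq_nsmul ℂ, Complex.ofReal_inv]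
  rw [mul_left_comm, ← mul_inv, sq_sqrt, mul_inv_cancel₀ hne, one_smul]

end IsCuntzFamily

namespace IsIdealOf

variable (hJ : IsIdealOf (coreOf t π ⊤) J)
include hJ

theorem eq_coreOf_of_one_mem (h1 : (1 : E) ∈ J) : J = coreOf t π ⊤ :=
  le_antisymm hJ.le fun b hb => by simpa using hJ.mul_left b hb 1 h1

/-- The functions `g` with `t_u g t_u^* ∈ J` for all words `u` of length `m`, an ideal of
`C(X̃)`. -/
def levelIdeal (h : IsCuntzFamily t) (m : ℕ) : Ideal C(Cover σ, ℂ) where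
  carrier := {g | ∀ u : List (Fin n), u.length = m → wordProd t u * π g * star (wordProd t u) ∈ J}
  add_mem' ha hb u hu := by
    rw [map_add, mul_add, add_mul]
    exact J.add_mem (ha u hu) (hb u hu)
  zero_mem' u _ := by simp
  smul_mem' k g hg u hu := by
    have factor : wordProd t u * π (k • g) * star (wordProd t u) =
        wordProd t u * π k * star (wordProd t u) * (wordProd t u * π g * star (wordProd t u)) :=
      calc _ = wordProd t u * π k * (star (wordProd t u) * wordProd t u) * π g *
            star (wordProd t u) := by
            rw [h.star_wordProd_mul_self, mul_one, smul_eq_mul, map_mul, ← mul_assoc]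
        _ = _ := by simp only [mul_assoc]
    rw [factor]
    exact hJ.mul_left _ (mem_coreOf rfl Submodule.mem_top) _ (hg u hu)

variable {h : IsCuntzFamily t} {m : ℕ} {g : C(Cover σ, ℂ)}

theorem mem_levelIdeal : g ∈ hJ.levelIdeal h m ↔
    ∀ u : List (Fin n), u.length = m → wordProd t u * π g * star (wordProd t u) ∈ J := Iff.rfl

theorem mem_levelIdeal_zero : g ∈ hJ.levelIdeal h 0 ↔ π g ∈ J := by
  simp [mem_levelIdeal]

theorem eq_coreOf_of_levelIdeal_eq_top (htop : hJ.levelIdeal h m = ⊤) : J = coreOf t π ⊤ := by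
  refine hJ.eq_coreOf_of_one_mem ?_
  rw [← h.sum_wordProd_mul_star m]
  refine J.sum_mem fun w hw => ?_
  have one_mem : (1 : C(Cover σ, ℂ)) ∈ hJ.levelIdeal h m := htop ▸ Submodule.mem_top
  simpa using one_mem w (mem_words.mp hw)

theorem comp_mem_levelIdeal (hcov : IsCovariant (coverMap σ) π t)
    (hg : g ∈ hJ.levelIdeal h m) (v : List (Fin n)) :
    g.comp (wordComp (coverMap σ) v) ∈ hJ.levelIdeal h (m + v.length) := by
  intro u hu
  set a := u.take m
  have ha : a.length = m := by simp [a, hu]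
  have hav : (a ++ v).length = u.length := by simp [ha, hu]
  have factor : wordProd t u * π (g.comp (wordComp (coverMap σ) v)) * star (wordProd t u) =
      wordProd t u * star (wordProd t (a ++ v)) * (wordProd t a * π g * star (wordProd t a)) *
        (wordProd t (a ++ v) * star (wordProd t u)) :=
    calc _ = wordProd t u * (star (wordProd t v) * (π g * wordProd t v)) *
          star (wordProd t u) := by
          rw [hcov.mul_wordProd, ← mul_assoc (star _), h.star_wordProd_mul_self, one_mul]
      _ = wordProd t u * (star (wordProd t (a ++ v)) * wordProd t a) * π g *
          (star (wordProd t a) * wordProd t (a ++ v)) * star (wordProd t u) := by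
        rw [h.star_append_mul_wordProd, h.star_wordProd_mul_append]
        simp only [mul_assoc]
      _ = _ := by simp only [mul_assoc]
  rw [factor]
  exact hJ.sandwich_mem (wordProd_mul_star_mem_coreOf hav.symm) (hg a ha)
    (wordProd_mul_star_mem_coreOf hav)

include h in
theorem mul_mul_star_mem (hα : IsInvariant (fun b => avg t * b * star (avg t)) J) {x : E}
    (hx : x ∈ J) (i : Fin n) : t i * x * star (t i) ∈ J := by
  have hc : (((Real.sqrt n)⁻¹ : ℝ) : ℂ) ≠ 0 := by
    exact_mod_cast inv_ne_zero (Real.sqrt_ne_zero'.mpr (Nat.cast_pos.mpr i.pos))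
  have hi : t i * star (t i) ∈ coreOf t π ⊤ := by
    simpa using wordProd_mul_star_mem_coreOf (t := t) (π := π) (u := [i]) (v := [i]) rfl
  rw [← J.smul_mem_iff (mul_ne_zero hc hc)]
  convert hJ.sandwich_mem hi (hα x hx) hi using 1
  calc _ = t i * (star (t i) * avg t) * x * (star (avg t) * t i) * star (t i) := by
        simp only [h.star_mul_avg, h.star_avg_mul, mul_smul_comm, smul_mul_assoc, mul_one,
          smul_smul]
    _ = _ := by simp only [mul_assoc]

theorem levelIdeal_mono (hα : IsInvariant (fun b => avg t * b * star (avg t)) J) :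
    Monotone (hJ.levelIdeal h) := by
  refine monotone_nat_of_le_succ fun m g hg u hu => ?_
  cases u with
  | nil => simp at hu
  | cons i u =>
    simpa only [wordProd_cons, star_mul, mul_assoc] using
      hJ.mul_mul_star_mem (h := h) hα (hg u (by simpa using hu)) i

end IsIdealOf

variable [CompactSpace X]

theorem IsMinimal.exists_finset_forall_wordMap_mem (hσ : IsMinimal σ) {U : Set X} (hU : IsOpen U)
    (hne : U.Nonempty) : ∃ s : Finset (List (Fin n)), ∀ x, ∃ v ∈ s, wordMap σ v x ∈ U := by
  simp only [← wordComp_apply]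
  obtain ⟨s, hs⟩ := isCompact_univ.elim_finite_subcover (fun v => wordComp σ v ⁻¹' U)
    (fun v => hU.preimage (wordComp σ v).continuous) fun x _ => by
      obtain ⟨_, hy, ⟨v, rfl⟩⟩ := (hσ x).inter_open_nonempty U hU hne
      exact Set.mem_iUnion.mpr ⟨v, by rwa [Set.mem_preimage, wordComp_apply]⟩
  exact ⟨s, fun x => by simpa using hs (Set.mem_univ x)⟩

theorem IsMinimal.exists_isUnit_sum_comp (hσ : IsMinimal σ) {F : C(Cover σ, ℂ)} {f : C(X, ℝ)}
    (hf : ∀ x, 0 ≤ f x) {x : X} (hx : 0 < f x) (hF : ∀ z, F z = f (coverProj σ z)) :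
    ∃ s : Finset (List (Fin n)), IsUnit (∑ v ∈ s, F.comp (wordComp (coverMap σ) v)) := by
  obtain ⟨s, hs⟩ := hσ.exists_finset_forall_wordMap_mem
    (isOpen_lt continuous_const f.continuous : IsOpen {y | 0 < f y}) ⟨x, hx⟩
  refine ⟨s, (ContinuousMap.isUnit_iff_forall_ne_zero _).mpr fun z => ?_⟩
  obtain ⟨v, hv, hpos⟩ := hs (coverProj σ z)
  have sum_pos : 0 < ∑ v ∈ s, f (wordMap σ v (coverProj σ z)) :=
    Finset.sum_pos' (fun _ _ => hf _) ⟨v, hv, hpos⟩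
  simp only [ContinuousMap.sum_apply, ContinuousMap.comp_apply, hF, coverProj_wordComp]
  simp only [wordComp_apply]
  exact_mod_cast sum_pos.ne'

variable [T2Space X]

theorem IsCuntzPair.eq_bot_or_eq_coreOf_of_isMinimal (h : IsCuntzPair t π)
    (hπ : Function.Injective π) (hσ : IsMinimal σ) (hJ : IsIdealOf (coreOf t π ⊤) J)
    (hα : IsInvariant (fun b => avg t * b * star (avg t)) J) : J = ⊥ ∨ J = coreOf t π ⊤ := by
  refine or_iff_not_imp_left.mpr fun hne => ?_
  obtain ⟨g, hgJ, hg⟩ : ∃ g, π g ∈ J ∧ g ≠ 0 := by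
    by_contra! hJπ
    exact hne (h.eq_bot_of_map_mem_imp_eq_zero hπ hJ hJπ)
  obtain ⟨w, f, k, hf, ⟨x, hx⟩, hk⟩ := exists_mul_comp_wordComp hg
  set F := k * g.comp (wordComp (coverMap σ) w)
  have hF : F ∈ hJ.levelIdeal h.toIsCuntzFamily (0 + w.length) :=
    Ideal.mul_mem_left _ k (hJ.comp_mem_levelIdeal h.covariant (hJ.mem_levelIdeal_zero.mpr hgJ) w)
  obtain ⟨s, hs⟩ := hσ.exists_isUnit_sum_comp (F := F) hf (hx ▸ one_pos) hk
  refine hJ.eq_coreOf_of_levelIdeal_eq_top (h := h.toIsCuntzFamily)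
    (m := 0 + w.length + s.sup List.length) (Ideal.eq_top_of_isUnit_mem _ ?_ hs)
  exact Ideal.sum_mem _ fun v hv => hJ.levelIdeal_mono hα
    (Nat.add_le_add_left (Finset.le_sup hv) _) (hJ.comp_mem_levelIdeal h.covariant hF v)

end InvariantIdeals

section InvariantSets

variable {X : Type u} [TopologicalSpace X] {n : ℕ} {σ : Fin n → C(X, X)} {Y : Set X}

/-- The points of the covering space all of whose coordinates `x₀, x₁, …` lie in `Y`. -/
def historySet (σ : Fin n → C(X, X)) (Y : Set X) : Set (Cover σ) := {z | ∀ k, z.1.2 k ∈ Y}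

theorem mapsTo_coverMap_historySet {i : Fin n} (hσY : Set.MapsTo (σ i) Y Y) :
    Set.MapsTo (coverMap σ i) (historySet σ Y) (historySet σ Y)
  | _, hz, 0 => hσY (hz 0)
  | _, hz, k + 1 => hz k

theorem mapsTo_shift_historySet : Set.MapsTo (shift σ) (historySet σ Y) (historySet σ Y) :=
  fun _ hz k => hz (k + 1)

theorem isClosed_historySet (hY : IsClosed Y) : IsClosed (historySet σ Y) := by
  simp only [historySet, Set.ofPred_forall]
  exact isClosed_iInter fun k => hY.preimage (Cover.continuous_point k)

theorem historySet_nonempty [CompactSpace X] [T2Space X] (hσ : IsSurjective σ) (hY : IsClosed Y)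
    (hne : Y.Nonempty) (hσY : ∀ i, Set.MapsTo (σ i) Y Y) : (historySet σ Y).Nonempty := by
  let Z : ℕ → Set (Cover σ) := fun k => {z | z.1.2 k ∈ Y}
  have Z_closed (k : ℕ) : IsClosed (Z k) := hY.preimage (Cover.continuous_point k)
  have Z_succ_subset (k : ℕ) : Z (k + 1) ⊆ Z k := fun z hz => by
    change z.1.2 k ∈ Y
    exact z.2 k ▸ hσY _ hz
  have Z_nonempty (k : ℕ) : (Z k).Nonempty := by
    induction k with
    | zero =>
      obtain ⟨y, hy⟩ := hne
      obtain ⟨z, rfl⟩ := coverProj_surjective hσ y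
      exact ⟨z, hy⟩
    | succ k ih =>
      obtain ⟨z, hz⟩ := ih
      exact ⟨coverMap σ (firstIndex z) z, hz⟩
  obtain ⟨z, hz⟩ := IsCompact.nonempty_iInter_of_sequence_nonempty_isCompact_isClosed Z
    Z_succ_subset Z_nonempty (Z_closed 0).isCompact Z_closed
  exact ⟨z, Set.mem_iInter.mp hz⟩

theorem mapsTo_closure_orbit (i : Fin n) (x : X) :
    Set.MapsTo (σ i) (closure (orbit σ x)) (closure (orbit σ x)) :=
  Set.MapsTo.closure (by rintro _ ⟨w, rfl⟩; exact ⟨i :: w, rfl⟩) (σ i).continuous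

theorem comp_mem_idealOfSet_compl {Z : Type*} [TopologicalSpace Z] {S : Set Z} {τ : C(Z, Z)}
    (hτ : Set.MapsTo τ S S) {g : C(Z, ℂ)} (hg : g ∈ ContinuousMap.idealOfSet ℂ Sᶜ) :
    g.comp τ ∈ ContinuousMap.idealOfSet ℂ Sᶜ := by
  simp only [ContinuousMap.mem_idealOfSet, compl_compl] at hg ⊢
  exact fun z hz => hg (hτ hz)

theorem exists_invariant_ideal [CompactSpace X] [T2Space X] (hσ : IsSurjective σ)
    (hmin : ¬ IsMinimal σ) :
    ∃ I : Ideal C(Cover σ, ℂ), I ≠ ⊥ ∧ I ≠ ⊤ ∧ (∀ i, ∀ g ∈ I, g.comp (coverMap σ i) ∈ I) ∧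
      ∀ g ∈ I, g.comp (shift σ) ∈ I := by
  obtain ⟨x, hx⟩ := not_forall.mp hmin
  obtain ⟨y, hy⟩ := not_forall.mp hx
  set Z := historySet σ (closure (orbit σ x))
  have Z_nonempty : Z.Nonempty := historySet_nonempty hσ isClosed_closure
    (Set.Nonempty.closure ⟨x, [], rfl⟩) fun i => mapsTo_closure_orbit i x
  have compl_Z_nonempty : Zᶜ.Nonempty := by
    obtain ⟨z, rfl⟩ := coverProj_surjective hσ y
    exact ⟨z, fun hz => hy (hz 0)⟩
  obtain ⟨w, hw⟩ := compl_Z_nonempty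
  rw [← ContinuousMap.setOfIdeal_ofSet_of_isOpen ℂ
    (isClosed_historySet isClosed_closure).isOpen_compl, ContinuousMap.mem_setOfIdeal] at hw
  obtain ⟨g, hg, hgw⟩ := hw
  refine ⟨ContinuousMap.idealOfSet ℂ Zᶜ, Submodule.ne_bot_iff _ |>.mpr
      ⟨g, hg, fun hg0 => hgw (by simp [hg0])⟩, (Ideal.ne_top_iff_one _).mpr fun h1 => ?_,
    fun i _ => comp_mem_idealOfSet_compl (mapsTo_coverMap_historySet (mapsTo_closure_orbit i x)),
    fun _ => comp_mem_idealOfSet_compl mapsTo_shift_historySet⟩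
  obtain ⟨z, hz⟩ := Z_nonempty
  exact one_ne_zero (ContinuousMap.mem_idealOfSet.mp h1 (by simpa using hz))

end InvariantSets

section InducedIdeals

variable {X : Type u} [TopologicalSpace X] {n : ℕ} {σ : Fin n → C(X, X)}
  {E : Type u} [CStarAlgebra E] {t : Fin n → E} {π : C(Cover σ, ℂ) →⋆ₐ[ℂ] E}
  {I I' : Ideal C(Cover σ, ℂ)}

theorem comp_wordComp_mem (hI : ∀ i, ∀ g ∈ I, g.comp (coverMap σ i) ∈ I) {g : C(Cover σ, ℂ)}
    (hg : g ∈ I) (w : List (Fin n)) : g.comp (wordComp (coverMap σ) w) ∈ I := by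
  induction w generalizing g with
  | nil => exact hg
  | cons i _ ih => exact ih (hI i g hg)

theorem avg_mul_mul_star_mem_coreOf {b : E} (hb : b ∈ coreOf t π I) :
    avg t * b * star (avg t) ∈ coreOf t π I := by
  refine coreOf_le_comap (L := LinearMap.mulRight ℂ (star (avg t)) ∘ₗ LinearMap.mulLeft ℂ (avg t))
    isClosed_coreOf ((continuous_mul_const _).comp (continuous_const_mul _))
    (fun u v g hg hl => ?_) hb
  simp only [LinearMap.comp_apply, LinearMap.mulLeft_apply, LinearMap.mulRight_apply]
  rw [star_avg, avg, smul_mul_assoc, smul_mul_assoc, mul_smul_comm, Finset.sum_mul,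
    Finset.sum_mul]
  refine Submodule.smul_mem _ _ (Submodule.smul_mem _ _ (Submodule.sum_mem _ fun i _ => ?_))
  rw [Finset.mul_sum]
  refine Submodule.sum_mem _ fun k _ => ?_
  simpa only [wordProd_cons, star_mul, mul_assoc] using
    mem_coreOf (t := t) (π := π) (u := i :: u) (v := k :: v) (by simp [hl]) hg

namespace IsCuntzPair

variable (h : IsCuntzPair t π)
include h

theorem generator_mul_generator_mem (hI : ∀ i, ∀ g ∈ I, g.comp (coverMap σ i) ∈ I)
    (hI' : ∀ i, ∀ g ∈ I', g.comp (coverMap σ i) ∈ I') {u v x y : List (Fin n)}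
    {f g : C(Cover σ, ℂ)} (huv : u.length = v.length) (hf : f ∈ I) (hxy : x.length = y.length)
    (hg : g ∈ I') :
    wordProd t u * π f * star (wordProd t v) * (wordProd t x * π g * star (wordProd t y)) ∈
      coreOf t π (I ⊓ I') := by
  have regroup : wordProd t u * π f * star (wordProd t v) *
      (wordProd t x * π g * star (wordProd t y)) =
      wordProd t u * π f * (star (wordProd t v) * wordProd t x) * π g * star (wordProd t y) := by
    simp only [mul_assoc]
  rw [regroup]
  by_cases hvx : v <+: x
  · obtain ⟨w, rfl⟩ := hvx
    have hmem : f.comp (wordComp (coverMap σ) w) * g ∈ I ⊓ I' :=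
      ⟨I.mul_mem_right _ (comp_wordComp_mem hI hf w), I'.mul_mem_left _ hg⟩
    rw [h.star_wordProd_mul_append, mul_assoc (wordProd t u), h.covariant.mul_wordProd]
    simpa only [wordProd_append, map_mul, mul_assoc] using
      mem_coreOf (t := t) (π := π) (u := u ++ w) (v := y) (by simp_all) hmem
  · by_cases hxv : x <+: v
    · obtain ⟨w, rfl⟩ := hxv
      have hmem : f * g.comp (wordComp (coverMap σ) w) ∈ I ⊓ I' :=
        ⟨I.mul_mem_right _ hf, I'.mul_mem_left _ (comp_wordComp_mem hI' hg w)⟩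
      rw [h.star_append_mul_wordProd, mul_assoc (wordProd t u * π f),
        h.covariant.star_wordProd_mul]
      simpa only [wordProd_append, map_mul, star_mul, mul_assoc] using
        mem_coreOf (t := t) (π := π) (u := u) (v := y ++ w) (by simp_all) hmem
    · rw [h.star_wordProd_mul_eq_zero hvx hxv]
      simp

theorem mul_mem_coreOf (hI : ∀ i, ∀ g ∈ I, g.comp (coverMap σ i) ∈ I)
    (hI' : ∀ i, ∀ g ∈ I', g.comp (coverMap σ i) ∈ I') {a b : E} (ha : a ∈ coreOf t π I)
    (hb : b ∈ coreOf t π I') : a * b ∈ coreOf t π (I ⊓ I') :=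
  coreOf_le_comap (L := LinearMap.mulRight ℂ b) isClosed_coreOf (continuous_mul_const b)
    (fun _ _ _ hf huv => coreOf_le_comap (L := LinearMap.mulLeft ℂ _) isClosed_coreOf
      (continuous_const_mul _)
      (fun _ _ _ hg hxy => h.generator_mul_generator_mem hI hI' huv hf hxy hg) hb) ha

theorem isIdealOf_coreOf (hI : ∀ i, ∀ g ∈ I, g.comp (coverMap σ i) ∈ I) :
    IsIdealOf (coreOf t π ⊤) (coreOf t π I) where
  le := coreOf_mono le_top
  closed := isClosed_coreOf
  mul_left b hb x hx := by
    simpa using h.mul_mem_coreOf (fun _ _ _ => Submodule.mem_top) hI hb hx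
  mul_right b hb x hx := by
    simpa using h.mul_mem_coreOf hI (fun _ _ _ => Submodule.mem_top) hx hb

theorem star_avg_mul_mul_mem_coreOf (hI : ∀ i, ∀ g ∈ I, g.comp (coverMap σ i) ∈ I) {b : E}
    (hb : b ∈ coreOf t π I) : star (avg t) * b * avg t ∈ coreOf t π I := by
  refine coreOf_le_comap (L := LinearMap.mulRight ℂ (avg t) ∘ₗ LinearMap.mulLeft ℂ (star (avg t)))
    isClosed_coreOf ((continuous_mul_const _).comp (continuous_const_mul _))
    (fun u v g hg hl => ?_) hb
  match u, v, hl with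
  | [], [], _ =>
    change star (avg t) * (wordProd t [] * π g * star (wordProd t [])) *
      ((((Real.sqrt n)⁻¹ : ℝ) : ℂ) • ∑ i, t i) ∈ _
    rw [wordProd_nil, one_mul, star_one, mul_one, mul_smul_comm, Finset.mul_sum]
    refine Submodule.smul_mem _ _ (Submodule.sum_mem _ fun i _ => ?_)
    rw [mul_assoc, h.covariant, ← mul_assoc, h.star_avg_mul, smul_mul_assoc, one_mul]
    exact Submodule.smul_mem _ _ (map_mem_coreOf (hI i g hg))
  | i :: u, k :: v, hl =>
    have factor : star (avg t) * (wordProd t (i :: u) * π g * star (wordProd t (k :: v))) * avg t =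
        star (avg t) * t i * (wordProd t u * π g * star (wordProd t v)) * (star (t k) * avg t) := by
      simp only [wordProd_cons, star_mul, mul_assoc]
    change star (avg t) * (_ * star (wordProd t (k :: v))) * avg t ∈ _
    rw [factor, h.star_avg_mul, h.star_mul_avg, smul_mul_assoc, mul_smul_comm, one_mul, mul_one]
    exact Submodule.smul_mem _ _ (Submodule.smul_mem _ _ (mem_coreOf (by simpa using hl) hg))

theorem isBiInvariant_coreOf (hn : n ≠ 0) (hI : ∀ i, ∀ g ∈ I, g.comp (coverMap σ i) ∈ I) :
    IsBiInvariant (fun b => avg t * b * star (avg t)) (coreOf t π ⊤) (coreOf t π I) := by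
  refine ⟨fun _ => avg_mul_mul_star_mem_coreOf, fun b _ hb => ?_⟩
  have cancel : star (avg t) * (avg t * b * star (avg t)) * avg t = b :=
    calc _ = star (avg t) * avg t * b * (star (avg t) * avg t) := by simp only [mul_assoc]
      _ = b := by rw [h.star_avg_mul_avg hn, one_mul, mul_one]
  exact cancel ▸ h.star_avg_mul_mul_mem_coreOf hI hb

variable [CompactSpace X] [T2Space X]

theorem one_notMem_coreOf (hπ : Function.Injective π) (htop : I ≠ ⊤)
    (hI : ∀ g ∈ I, g.comp (shift σ) ∈ I) : (1 : E) ∉ coreOf t π I := by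
  intro h1
  obtain ⟨g, hg, L, hL⟩ := h.exists_norm_diagPart_sub_lt hI h1 one_pos
  have norm_lt : ‖1 - g‖ < 1 := by
    have := hL L le_rfl
    rwa [← map_one π, h.diagPart_map, ← map_sub, NonUnitalStarAlgHom.norm_map π hπ] at this
  exact htop (I.eq_top_of_isUnit_mem hg (by simpa using isUnit_one_sub_of_norm_lt_one norm_lt))

theorem isMinimal_of_forall_isBiInvariant (hn : n ≠ 0) (hπ : Function.Injective π)
    (hσ : IsSurjective σ)
    (hJ : ∀ J : Submodule ℂ E, IsIdealOf (coreOf t π ⊤) J →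
      IsBiInvariant (fun b => avg t * b * star (avg t)) (coreOf t π ⊤) J →
        J = ⊥ ∨ J = coreOf t π ⊤) : IsMinimal σ := by
  by_contra hmin
  obtain ⟨I, hbot, htop, hI, hIshift⟩ := exists_invariant_ideal hσ hmin
  rcases hJ _ (h.isIdealOf_coreOf hI) (h.isBiInvariant_coreOf hn hI) with eq_bot | eq_top
  · obtain ⟨g, hg, hg0⟩ := Submodule.exists_mem_ne_zero_of_ne_bot hbot
    have map_eq_zero : π g = 0 := by simpa [eq_bot] using map_mem_coreOf (t := t) (π := π) hg
    exact hg0 (hπ (map_eq_zero.trans (map_zero π).symm))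
  · refine h.one_notMem_coreOf hπ htop hIshift ?_
    rw [eq_top, ← map_one π]
    exact map_mem_coreOf Submodule.mem_top

end IsCuntzPair

end InducedIdeals

end MvDyn

end

theorem corollaryC_general {X : Type u} [TopologicalSpace X] [CompactSpace X] [T2Space X]
    {n : ℕ} (hn : n ≠ 0) (σ : Fin n → C(X, X)) (hσ : MvDyn.IsSurjective σ)
    {E : Type u} [CStarAlgebra E] [PartialOrder E] [StarOrderedRing E]
    (j : MvDyn.CovAlg σ →ₐ[ℂ] E) (hj : MvDyn.IsCStarEnvelope σ j) :
    (∃! π : C(MvDyn.Cover σ, ℂ) →⋆ₐ[ℂ] E, MvDyn.IsCoverExtension σ j π) ∧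
    ∀ π : C(MvDyn.Cover σ, ℂ) →⋆ₐ[ℂ] E, MvDyn.IsCoverExtension σ j π →
      List.TFAE [
        MvDyn.IsMinimal σ,
        ∀ J : Submodule ℂ E, MvDyn.IsIdealOf (MvDyn.core σ j π) J →
          MvDyn.IsInvariant (MvDyn.endo σ j) J → J = ⊥ ∨ J = MvDyn.core σ j π,
        ∀ J : Submodule ℂ E, MvDyn.IsIdealOf (MvDyn.core σ j π) J →
          MvDyn.IsBiInvariant (MvDyn.endo σ j) (MvDyn.core σ j π) J →
            J = ⊥ ∨ J = MvDyn.core σ j π] := by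
  obtain ⟨π₀, pair₀, hext₀⟩ := hj.exists_isCuntzPair hσ
  have isCuntzPair {π : C(MvDyn.Cover σ, ℂ) →⋆ₐ[ℂ] E} (hext : MvDyn.IsCoverExtension σ j π) :
      MvDyn.IsCuntzPair (fun i => j (MvDyn.gen σ i)) π := ⟨pair₀.toIsCuntzFamily, hext.covariant⟩
  refine ⟨⟨π₀, hext₀, fun π hext => (isCuntzPair hext).unique pair₀ fun f =>
    (hext.extend f).trans (hext₀.extend f).symm⟩, fun π hext => ?_⟩
  have pair := isCuntzPair hext
  have injective : Function.Injective π := pair.injective fun f hf =>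
    hj.eq_zero_of_map_coeff_eq_zero hσ ((hext.extend f).symm.trans hf)
  rw [MvDyn.core_eq_coreOf_top]
  tfae_have 1 → 2 := fun hmin J hJ hα =>
    pair.eq_bot_or_eq_coreOf_of_isMinimal injective hmin hJ hα
  tfae_have 2 → 3 := fun h2 J hJ hα => h2 J hJ hα.1
  tfae_have 3 → 1 := fun h3 => pair.isMinimal_of_forall_isBiInvariant hn injective hσ h3
  tfae_finish

theorem corollaryC {X : Type u} [TopologicalSpace X] [CompactSpace X] [T2Space X]
    {n : ℕ} (hn : 2 ≤ n) (σ : Fin n → C(X, X)) (hσ : MvDyn.IsSurjective σ)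
    {E : Type u} [CStarAlgebra E] [PartialOrder E] [StarOrderedRing E]
    (j : MvDyn.CovAlg σ →ₐ[ℂ] E) (hj : MvDyn.IsCStarEnvelope σ j) :
    (∃! π : C(MvDyn.Cover σ, ℂ) →⋆ₐ[ℂ] E, MvDyn.IsCoverExtension σ j π) ∧
    ∀ π : C(MvDyn.Cover σ, ℂ) →⋆ₐ[ℂ] E, MvDyn.IsCoverExtension σ j π →
      List.TFAE [
        MvDyn.IsMinimal σ,
        ∀ J : Submodule ℂ E, MvDyn.IsIdealOf (MvDyn.core σ j π) J →
          MvDyn.IsInvariant (MvDyn.endo σ j) J → J = ⊥ ∨ J = MvDyn.core σ j π,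
        ∀ J : Submodule ℂ E, MvDyn.IsIdealOf (MvDyn.core σ j π) J →
          MvDyn.IsBiInvariant (MvDyn.endo σ j) (MvDyn.core σ j π) J →
            J = ⊥ ∨ J = MvDyn.core σ j π] :=
  corollaryC_general (by omega) σ hσ j hj
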